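/- Let $M$ be a closed (compact, without boundary, not necessarily connected) smooth $m$-dimensional manifold, let $n\ge 0$ and $k\ge 2$ be integers, and let $F:M\times[0,1]\to\mathbb R^n$ be a smooth map such that every $F_t=F(\cdot,t):M\to\mathbb R^n$ is a smooth embedding. For an embedding $f:M\to\mathbb R^n$ and $j\ge 2$, a closed billiard trajectory with $j$ vertices is a tuple $(x_i)_{i\in\mathbb Z/j}$ of points of $M$ with $x_i\ne x_{i+1}$ for all $i$, satisfying the reflection law $$\frac{f(x_i)-f(x_{i+1})}{\|f(x_i)-f(x_{i+1})\|}-\frac{f(x_{i-1})-f(x_i)}{\|f(x_{i-1})-f(x_i)\|}\ \perp\ df_{x_i}(T_{x_i}M)\qquad (i\in\mathbb Z/j).$$ Let $l_j(x)=\sum_{i\in\mathbb Z/j}\|f(x_i)-f(x_{i+1})\|$ on $M^{j}$. Call $f$ generic (up to $k$) if for every $2\le j\le k$ every critical point of $l_j$ with $x_i\neq x_{i+1}$ for all $i$ is nondegenerate, i.e. the Hessian of $l_j$ there is a nondegenerate bilinear form. Suppose that $F_t$ is generic up to $k$ for every $t\in[0,1]$. Then for every $t\in[0,1]$ the number of closed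 billiard trajectories of $F_t$ with $k$ vertices is finite, and it does not depend on $t$. This holds both when trajectories are counted as labelled tuples $(x_i)_{i\in\mathbb Z/k}$ and when they are counted up to the action of the dihedral group $D_k$ (rotations and reversals of the labels). -/

import Mathlib

open scoped Manifold ContDiff

noncomputable section

namespace Billiard

section Polygons

variable {n m : ℕ} {M : Type*} [TopologicalSpace M] [ChartedSpace (EuclideanSpace ℝ (Fin m)) M]

/-- The unit vector pointing from `q` to `p`, i.e. `(p - q) / ‖p - q‖`. -/
def direction (p q : EuclideanSpace ℝ (Fin n)) : EuclideanSpace ℝ (Fin n) :=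
  ‖p - q‖⁻¹ • (p - q)

/-- A closed billiard trajectory with `k` vertices for the embedding `f : M → ℝⁿ`: consecutive
vertices are distinct (indices are taken in `ℤ/k`), and at each vertex the reflection law holds,
that is, the difference of the unit vectors of the two adjacent edges is orthogonal to the tangent
space of `f(M)`. -/
def IsClosedTrajectory (f : M → EuclideanSpace ℝ (Fin n)) {k : ℕ} (x : ZMod k → M) : Prop :=
  (∀ i, x i ≠ x (i + 1)) ∧
    ∀ i, ∀ v : TangentSpace (𝓡 m) (x i),
      inner ℝ (direction (f (x i)) (f (x (i + 1))) - direction (f (x (i - 1))) (f (x i)))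
        (mfderiv (𝓡 m) 𝓘(ℝ, EuclideanSpace ℝ (Fin n)) f (x i) v :
          EuclideanSpace ℝ (Fin n)) = 0

/-- The length function `l_k` on `M^k`: the perimeter of the closed polygon. -/
def length (f : M → EuclideanSpace ℝ (Fin n)) {k : ℕ} [NeZero k] (x : ZMod k → M) : ℝ :=
  ∑ i, ‖f (x i) - f (x (i + 1))‖

/-- The length function `l_k` written in the product chart of `M^k` centred at `x`. -/
def lengthInChart (f : M → EuclideanSpace ℝ (Fin n)) {k : ℕ} [NeZero k] (x : ZMod k → M)
    (u : ZMod k → EuclideanSpace ℝ (Fin m)) : ℝ :=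
  length f fun i => (extChartAt (𝓡 m) (x i)).symm (u i)

/-- The coordinates of `x` in the product chart of `M^k` centred at `x`. -/
def coords {k : ℕ} (x : ZMod k → M) : ZMod k → EuclideanSpace ℝ (Fin m) :=
  fun i => extChartAt (𝓡 m) (x i) (x i)

/-- `x` is a critical point of `l_k`. It is meant for polygons whose consecutive vertices are
distinct; `l_k` is smooth near those. -/
def IsCriticalPoint (f : M → EuclideanSpace ℝ (Fin n)) {k : ℕ} [NeZero k]
    (x : ZMod k → M) : Prop :=
  fderiv ℝ (lengthInChart (m := m) f x) (coords x) = 0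

/-- The Hessian of `l_k` at `x`, in the product chart, is a nondegenerate bilinear form. -/
def HasNondegenerateHessian (f : M → EuclideanSpace ℝ (Fin n)) {k : ℕ} [NeZero k]
    (x : ZMod k → M) : Prop :=
  ∀ v : ZMod k → EuclideanSpace ℝ (Fin m),
    (∀ w, fderiv ℝ (fderiv ℝ (lengthInChart (m := m) f x)) (coords x) v w = 0) → v = 0

/-- All critical points of `l_k` with distinct consecutive vertices are nondegenerate. -/
def LengthIsMorse (f : M → EuclideanSpace ℝ (Fin n)) (k : ℕ) [NeZero k] : Prop :=
  ∀ x : ZMod k → M, (∀ i, x i ≠ x (i + 1)) →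
    IsCriticalPoint (m := m) f x → HasNondegenerateHessian (m := m) f x

/-- Genericity of `f` for polygons with at most `k` vertices. -/
def IsGenericUpTo (f : M → EuclideanSpace ℝ (Fin n)) (k : ℕ) : Prop :=
  ∀ (j : ℕ) [NeZero j], 2 ≤ j → j ≤ k → LengthIsMorse (m := m) f j

/-- The set of closed billiard trajectories with `k` vertices, as labelled `k`-tuples. -/
def trajectories (f : M → EuclideanSpace ℝ (Fin n)) (k : ℕ) : Set (ZMod k → M) :=
  {x | IsClosedTrajectory (m := m) f x}

end Polygons

/-- Two labelled polygons are equivalent if they differ by an element of the dihedral group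
`D_k`, i.e. by a rotation or a reflection of the labels. -/
def dihedralSetoid (k : ℕ) (M : Type*) : Setoid (ZMod k → M) where
  r x y := ∃ c : ZMod k, (∀ i, y i = x (c + i)) ∨ (∀ i, y i = x (c - i))
  iseqv :=
    { refl := fun x => ⟨0, Or.inl fun i => by simp⟩
      symm := by
        rintro x y ⟨c, h | h⟩
        · exact ⟨-c, Or.inl fun i => by rw [h]; congr 1; ring⟩
        · exact ⟨c, Or.inr fun i => by rw [h]; congr 1; ring⟩
      trans := by
        rintro x y z ⟨c, h | h⟩ ⟨d, h' | h'⟩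
        · exact ⟨c + d, Or.inl fun i => by rw [h', h]; congr 1; ring⟩
        · exact ⟨c + d, Or.inr fun i => by rw [h', h]; congr 1; ring⟩
        · exact ⟨c - d, Or.inr fun i => by rw [h', h]; congr 1; ring⟩
        · exact ⟨c - d, Or.inl fun i => by rw [h', h]; congr 1; ring⟩ }

/-- The closed billiard trajectories with `k` vertices, up to the dihedral group: the choice of
the initial vertex and of the direction of travel is forgotten. -/
def unlabelledTrajectories {n m : ℕ} {M : Type*} [TopologicalSpace M]
    [ChartedSpace (EuclideanSpace ℝ (Fin m)) M] (f : M → EuclideanSpace ℝ (Fin n)) (k : ℕ) :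
    Set (Quotient (dihedralSetoid k M)) :=
  Quotient.mk (dihedralSetoid k M) '' trajectories (m := m) f k

end Billiard

end

/-! Closed billiard trajectories are the critical points of the perimeter `l_k`. When they are
nondegenerate, the inverse function theorem with parameters, applied to the differential of `l_k` in
a product chart, continues each trajectory of `F_t` to exactly one nearby trajectory of `F_s` for
`s` close to `t`. As `M ^ k` is compact, the number of trajectories is therefore finite and locally
constant as soon as the set of pairs of a parameter and a trajectory is closed.

Closedness could only fail because edges shrink to points in the limit. Not all of them do, since
the edges add up to zero. The limiting direction of a collapsing edge is tangent to `F_t(M)`, so the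
reflection law forces the limit polygon to go straight on at the ends of such an edge. Deleting the
collapsed edges leaves a trajectory with fewer vertices, one of which is passed straight on in a
direction tangent to `F_t(M)`. Moving that vertex in this direction is a degenerate direction of the
Hessian, which genericity excludes.

The count up to the dihedral group is the same argument in the Hausdorff quotient of `M ^ k`. -/

noncomputable section

namespace Billiard

open Set Filter Topology Metric Asymptotics
open scoped NNReal

/-! ### Counting the points of a family of fibres -/

section Counting

variable {X Y I : Type*} [TopologicalSpace X] [TopologicalSpace Y] [TopologicalSpace I]
  {T : I → Set X} {t₀ : I}

/-- The point `x` of the fibre over `t₀` of a family of sets continues to nearby parameters in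
exactly one way: every neighbourhood of `x` meets all nearby fibres, and some neighbourhood of `x`
meets each of them in at most one point. -/
def PersistsUniquely (T : I → Set X) (t₀ : I) (x : X) : Prop :=
  (∀ U ∈ 𝓝 x, ∀ᶠ t in 𝓝 t₀, (U ∩ T t).Nonempty) ∧
    ∃ U ∈ 𝓝 x, ∀ᶠ t in 𝓝 t₀, (U ∩ T t).Subsingleton

theorem finite_of_isCompact_of_inter_subsingleton {s : Set X} (hs : IsCompact s)
    (h : ∀ x ∈ s, ∃ U ∈ 𝓝 x, (U ∩ s).Subsingleton) : s.Finite := by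
  choose! U hU hsub using h
  obtain ⟨c, hc, hcov⟩ := hs.elim_nhds_subcover U hU
  refine (c.finite_toSet.biUnion fun x hx => (hsub x (hc x hx)).finite).subset fun y hy => ?_
  obtain ⟨x, hx, hyx⟩ := mem_iUnion₂.1 (hcov hy)
  exact mem_biUnion hx ⟨hyx, hy⟩

theorem finite_fibre [CompactSpace X] (hclosed : IsClosed {p : X × I | p.1 ∈ T p.2})
    (hpers : ∀ x ∈ T t₀, PersistsUniquely T t₀ x) : (T t₀).Finite := by
  have hfibre : IsClosed (T t₀) :=
    hclosed.preimage (f := fun x : X => (x, t₀)) (Continuous.prodMk_left t₀)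
  refine finite_of_isCompact_of_inter_subsingleton hfibre.isCompact fun x hx => ?_
  obtain ⟨-, U, hU, hsub⟩ := hpers x hx
  exact ⟨U, hU, hsub.self_of_nhds⟩

theorem eventually_fibre_subset [CompactSpace X] (hclosed : IsClosed {p : X × I | p.1 ∈ T p.2})
    {U : Set X} (hU : IsOpen U) (hsub : T t₀ ⊆ U) : ∀ᶠ t in 𝓝 t₀, T t ⊆ U := by
  have hbad : IsClosed (Prod.snd '' ({p : X × I | p.1 ∈ T p.2} ∩ Prod.fst ⁻¹' Uᶜ)) :=
    isClosedMap_snd_of_compactSpace _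
      (hclosed.inter (hU.isClosed_compl.preimage continuous_fst))
  refine mem_of_superset (hbad.isOpen_compl.mem_nhds ?_) fun t ht x hx => ?_
  · rintro ⟨⟨x, _⟩, ⟨hx, hxU⟩, rfl⟩
    exact hxU (hsub hx)
  · by_contra hxU
    exact ht ⟨(x, t), ⟨hx, hxU⟩, rfl⟩

theorem exists_pairwiseDisjoint_uniqueness_nhds [T2Space X] (hfin : (T t₀).Finite)
    (hpers : ∀ x ∈ T t₀, PersistsUniquely T t₀ x) :
    ∃ U : X → Set X, (∀ x ∈ T t₀, IsOpen (U x) ∧ x ∈ U x) ∧ (T t₀).PairwiseDisjoint U ∧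
      ∀ᶠ t in 𝓝 t₀, ∀ x ∈ T t₀, (U x ∩ T t).Subsingleton := by
  obtain ⟨D, hD, hdisj⟩ := hfin.t2_separation
  choose! N hN hsub using fun x hx => (hpers x hx).2
  refine ⟨fun x => D x ∩ interior (N x), fun x hx => ⟨(hD x).2.inter isOpen_interior,
    (hD x).1, mem_interior_iff_mem_nhds.2 (hN x hx)⟩,
    hdisj.mono fun x => inter_subset_left, ?_⟩
  filter_upwards [(eventually_all_finite hfin).2 hsub] with t ht x hx
  exact (ht x hx).anti <| inter_subset_inter_left _ <| inter_subset_right.trans interior_subset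

theorem eventually_ncard_fibre_eq [T2Space X] [CompactSpace X]
    (hclosed : IsClosed {p : X × I | p.1 ∈ T p.2})
    (hpers : ∀ x ∈ T t₀, PersistsUniquely T t₀ x) :
    ∀ᶠ t in 𝓝 t₀, (T t).ncard = (T t₀).ncard := by
  have hfin := finite_fibre hclosed hpers
  obtain ⟨U, hU, hdisj, hsub⟩ := exists_pairwiseDisjoint_uniqueness_nhds hfin hpers
  have hne : ∀ᶠ t in 𝓝 t₀, ∀ x ∈ T t₀, (U x ∩ T t).Nonempty :=
    (eventually_all_finite hfin).2 fun x hx =>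
      (hpers x hx).1 _ ((hU x hx).1.mem_nhds (hU x hx).2)
  have hcov : ∀ᶠ t in 𝓝 t₀, T t ⊆ ⋃ x ∈ T t₀, U x :=
    eventually_fibre_subset hclosed (isOpen_biUnion fun x hx => (hU x hx).1)
      fun x hx => mem_biUnion hx (hU x hx).2
  filter_upwards [hsub, hne, hcov] with t hsub hne hcov
  choose! φ hφ using hne
  have hbij : BijOn φ (T t₀) (T t) := by
    refine ⟨fun x hx => (hφ x hx).2, fun x hx y hy hxy => ?_, fun y hy => ?_⟩
    · exact hdisj.elim_set hx hy (φ x) (hφ x hx).1 (hxy ▸ (hφ y hy).1)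
    · obtain ⟨x, hx, hyx⟩ := mem_iUnion₂.1 (hcov hy)
      exact ⟨x, hx, hsub x hx (hφ x hx) ⟨hyx, hy⟩⟩
  exact hbij.ncard_eq.symm

theorem ncard_fibre_eq [T2Space X] [CompactSpace X] [PreconnectedSpace I]
    (hclosed : IsClosed {p : X × I | p.1 ∈ T p.2})
    (hpers : ∀ t, ∀ x ∈ T t, PersistsUniquely T t x) (s t : I) :
    (T s).ncard = (T t).ncard :=
  ((IsLocallyConstant.iff_eventually_eq fun t => (T t).ncard).2 fun t₀ =>
    eventually_ncard_fibre_eq hclosed (hpers t₀)).apply_eq_of_preconnectedSpace s t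

section Quotient

variable {π : X → Y}

theorem isClosed_image_family (hπ : IsOpenQuotientMap π)
    (hinv : ∀ t x y, π x = π y → x ∈ T t → y ∈ T t)
    (hclosed : IsClosed {p : X × I | p.1 ∈ T p.2}) :
    IsClosed {q : Y × I | q.1 ∈ π '' T q.2} := by
  rw [← (hπ.prodMap .id).isQuotientMap.isClosed_preimage]
  convert hclosed using 1
  ext ⟨x, t⟩
  exact ⟨fun ⟨y, hy, hyx⟩ => hinv t y x hyx hy, mem_image_of_mem π⟩

theorem PersistsUniquely.image (hπ : IsOpenQuotientMap π)
    (hinv : ∀ t x y, π x = π y → x ∈ T t → y ∈ T t) {x : X} (h : PersistsUniquely T t₀ x) :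
    PersistsUniquely (fun t => π '' T t) t₀ (π x) := by
  obtain ⟨hne, U, hU, hsub⟩ := h
  refine ⟨fun V hV => ?_, π '' U, hπ.isOpenMap.image_mem_nhds hU, ?_⟩
  · filter_upwards [hne _ (hπ.continuous.continuousAt.preimage_mem_nhds hV)]
    rintro t ⟨y, hyV, hy⟩
    exact ⟨π y, hyV, mem_image_of_mem π hy⟩
  · filter_upwards [hsub] with t ht
    rintro _ ⟨⟨u, hu, rfl⟩, y, hy, hyu⟩ _ ⟨⟨v, hv, rfl⟩, z, hz, hzv⟩
    exact congrArg π (ht ⟨hu, hinv t y u hyu hy⟩ ⟨hv, hinv t z v hzv hz⟩)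

theorem ncard_image_fibre_eq [T2Space Y] [CompactSpace X] [PreconnectedSpace I]
    (hπ : IsOpenQuotientMap π) (hinv : ∀ t x y, π x = π y → x ∈ T t → y ∈ T t)
    (hclosed : IsClosed {p : X × I | p.1 ∈ T p.2})
    (hpers : ∀ t, ∀ x ∈ T t, PersistsUniquely T t x) (s t : I) :
    (π '' T s).ncard = (π '' T t).ncard := by
  have : CompactSpace Y := hπ.surjective.compactSpace hπ.continuous
  refine ncard_fibre_eq (T := fun t => π '' T t) (isClosed_image_family hπ hinv hclosed) ?_ s t
  rintro t _ ⟨x, hx, rfl⟩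
  exact (hpers t x hx).image hπ hinv

variable {r : Setoid X} {ι : Type*} {σ : ι → X → X}

theorem isOpenQuotientMap_quotient_mk (hσ : ∀ g, Continuous (σ g))
    (hr : ∀ x y, r x y ↔ ∃ g, y = σ g x) : IsOpenQuotientMap (Quotient.mk r) := by
  refine ⟨Quotient.mk_surjective, continuous_quot_mk, fun U hU => ?_⟩
  have hpre : Quotient.mk r ⁻¹' (Quotient.mk r '' U) = ⋃ g, σ g ⁻¹' U := by
    ext x
    simp only [mem_preimage, mem_image, mem_iUnion]
    constructor
    · rintro ⟨y, hy, hyx⟩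
      obtain ⟨g, rfl⟩ := (hr x y).1 (Quotient.exact hyx.symm)
      exact ⟨g, hy⟩
    · rintro ⟨g, hg⟩
      exact ⟨σ g x, hg, (Quotient.sound ((hr x _).2 ⟨g, rfl⟩)).symm⟩
  rw [← isQuotientMap_quotient_mk'.isOpen_preimage]
  exact hpre ▸ isOpen_iUnion fun g => hU.preimage (hσ g)

theorem t2Space_quotient [T2Space X] [Finite ι] (hσ : ∀ g, Continuous (σ g))
    (hr : ∀ x y, r x y ↔ ∃ g, y = σ g x) : T2Space (Quotient r) := by
  rw [t2Space_iff_of_isOpenQuotientMap (isOpenQuotientMap_quotient_mk hσ hr)]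
  have hrel : {q : X × X | Quotient.mk r q.1 = Quotient.mk r q.2} =
      ⋃ g, {q | q.2 = σ g q.1} := by
    ext q
    simp only [mem_ofPred_eq, mem_iUnion, Quotient.eq, hr]
  rw [hrel]
  exact isClosed_iUnion_of_finite fun g =>
    isClosed_eq continuous_snd ((hσ g).comp continuous_fst)

end Quotient

end Counting

/-! ### Strict differentiability with parameters -/

section Parameter

variable {I V W : Type*} [TopologicalSpace I] [NormedAddCommGroup V] [NormedSpace ℝ V]
  [NormedAddCommGroup W] [NormedSpace ℝ W] {G : I → V → W} {t₀ : I} {u₀ : V}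

/-- Strict differentiability of `G t₀` at `u₀` with derivative `A`, locally uniform in the
parameter: the increments of `G t` near `u₀` are those of `A` up to a small relative error, for all
`t` near `t₀`. -/
def HasUniformStrictFDerivAt (G : I → V → W) (A : V →L[ℝ] W) (t₀ : I) (u₀ : V) : Prop :=
  (fun q : I × V × V => G q.1 q.2.1 - G q.1 q.2.2 - A (q.2.1 - q.2.2)) =o[𝓝 (t₀, u₀, u₀)]
    fun q => q.2.1 - q.2.2

theorem hasUniformStrictFDerivAt_of_continuousAt {G' : I × V → V →L[ℝ] W}
    (hG : ∀ᶠ p in 𝓝 (t₀, u₀), HasFDerivAt (G p.1) (G' p) p.2) (hG' : ContinuousAt G' (t₀, u₀)) :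
    HasUniformStrictFDerivAt G (G' (t₀, u₀)) t₀ u₀ := by
  refine isLittleO_iff.2 fun c hc => ?_
  have hclose : ∀ᶠ p in 𝓝 (t₀, u₀), ‖G' p - G' (t₀, u₀)‖ ≤ c := by
    filter_upwards [hG'.eventually (ball_mem_nhds _ hc)] with p hp
    exact (mem_ball_iff_norm.1 hp).le
  obtain ⟨P, hP, Q, hQ, hPQ⟩ := eventually_prod_iff.1
    ((hG.and hclose).filter_mono nhds_prod_eq.ge)
  obtain ⟨δ, hδ, hball⟩ := Metric.mem_nhds_iff.1 hQ
  filter_upwards [prod_mem_nhds hP (prod_mem_nhds (ball_mem_nhds u₀ hδ) (ball_mem_nhds u₀ hδ))]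
    with ⟨t, a, b⟩ ⟨ht, ha, hb⟩
  exact (convex_ball u₀ δ).norm_image_sub_le_of_norm_hasFDerivWithin_le'
    (fun u hu => (hPQ ht (hball hu)).1.hasFDerivWithinAt) (fun u hu => (hPQ ht (hball hu)).2) hb ha

namespace HasUniformStrictFDerivAt

theorem eventually_approximatesLinearOn {A : V →L[ℝ] W} (h : HasUniformStrictFDerivAt G A t₀ u₀)
    {c : ℝ≥0} (hc : 0 < c) : ∀ᶠ ε in 𝓝[>] (0 : ℝ), ∀ᶠ t in 𝓝 t₀,
      ApproximatesLinearOn (G t) A (closedBall u₀ ε) c := by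
  have hbound := isLittleO_iff.1 h (NNReal.coe_pos.2 hc)
  obtain ⟨P, hP, Q, hQ, hPQ⟩ := eventually_prod_iff.1 (hbound.filter_mono nhds_prod_eq.ge)
  obtain ⟨δ, hδ, hball⟩ := Metric.mem_nhds_iff.1 hQ
  filter_upwards [Ioo_mem_nhdsGT hδ] with ε hε
  filter_upwards [hP] with t ht a ha b hb
  refine hPQ (y := (a, b)) ht (hball ?_)
  rw [← ball_prod_same]
  exact ⟨closedBall_subset_ball hε.2 ha, closedBall_subset_ball hε.2 hb⟩

theorem exists_eventually_injOn {e : V ≃L[ℝ] W}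
    (h : HasUniformStrictFDerivAt G (e : V →L[ℝ] W) t₀ u₀) :
    ∃ s ∈ 𝓝 u₀, ∀ᶠ t in 𝓝 t₀, InjOn (G t) s := by
  rcases subsingleton_or_nontrivial V with hV | hV
  · exact ⟨univ, univ_mem, Eventually.of_forall fun t => injOn_of_subsingleton _ _⟩
  have hN : 0 < ‖(e.symm : W →L[ℝ] V)‖₊⁻¹ := inv_pos.2 e.nnnorm_symm_pos
  obtain ⟨ε, happrox, hε⟩ :=
    ((h.eventually_approximatesLinearOn (half_pos hN)).and self_mem_nhdsWithin).exists
  exact ⟨_, closedBall_mem_nhds u₀ hε,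
    happrox.mono fun t ht => ht.injOn (Or.inr (half_lt_self hN))⟩

theorem eventually_exists_zero [CompleteSpace V] {e : V ≃L[ℝ] W}
    (h : HasUniformStrictFDerivAt G (e : V →L[ℝ] W) t₀ u₀)
    (hcont : ContinuousAt (fun t => G t u₀) t₀) (hzero : G t₀ u₀ = 0) {s : Set V}
    (hs : s ∈ 𝓝 u₀) : ∀ᶠ t in 𝓝 t₀, ∃ u ∈ s, G t u = 0 := by
  rcases subsingleton_or_nontrivial V with hV | hV
  · have : Subsingleton W := e.symm.toEquiv.subsingleton
    exact Eventually.of_forall fun t => ⟨u₀, mem_of_mem_nhds hs, Subsingleton.elim _ _⟩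
  set N : ℝ≥0 := ‖(e.symm : W →L[ℝ] V)‖₊⁻¹
  have hN : 0 < N := inv_pos.2 e.nnnorm_symm_pos
  obtain ⟨δ, hδ, hball⟩ := Metric.mem_nhds_iff.1 hs
  obtain ⟨ε, happrox, hε⟩ := ((h.eventually_approximatesLinearOn (half_pos hN)).and
    (Ioo_mem_nhdsGT hδ)).exists
  have hρ : 0 < ((N : ℝ) - (N / 2 : ℝ≥0)) * ε :=
    mul_pos (sub_pos.2 (NNReal.coe_lt_coe.2 (half_lt_self hN))) hε.1
  have hsmall : ∀ᶠ t in 𝓝 t₀, G t u₀ ∈ ball 0 (((N : ℝ) - (N / 2 : ℝ≥0)) * ε) :=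
    hcont (hzero ▸ ball_mem_nhds _ hρ)
  filter_upwards [happrox, hsmall] with t ht hGt
  obtain ⟨u, hu, hu0⟩ := ht.surjOn_closedBall_of_nonlinearRightInverse
    e.toNonlinearRightInverse hε.1.le Subset.rfl
    (mem_closedBall_comm.1 (ball_subset_closedBall hGt))
  exact ⟨u, hball (closedBall_subset_ball hε.2 hu), hu0⟩

theorem mem_range_of_tendsto_normalize_sub [CompleteSpace V] {A : V →L[ℝ] W}
    (h : HasUniformStrictFDerivAt G A t₀ u₀) {K : ℝ≥0} (hA : AntilipschitzWith K A)
    {α : Type*} {l : Filter α} [l.NeBot] {τ : α → I} {a b : α → V} {e : W}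
    (hτ : Tendsto τ l (𝓝 t₀)) (ha : Tendsto a l (𝓝 u₀)) (hb : Tendsto b l (𝓝 u₀))
    (he : Tendsto (fun z => NormedSpace.normalize (G (τ z) (a z) - G (τ z) (b z))) l (𝓝 e)) :
    e ∈ range A := by
  set w : α → V := fun z => a z - b z
  set y : α → W := fun z => G (τ z) (a z) - G (τ z) (b z)
  have hrem : (fun z => y z - A (w z)) =o[l] w :=
    h.comp_tendsto (hτ.prodMk_nhds (ha.prodMk_nhds hb))
  have hw : w =O[l] fun z => A (w z) := IsBigO.of_bound K <| Eventually.of_forall fun z => by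
    simpa only [dist_zero_right, map_zero] using hA.le_mul_dist (w z) 0
  have hequiv : IsEquivalent l y fun z => A (w z) := hrem.trans_isBigO hw
  have hwy : (fun z => y z - A (w z)) =o[l] y := hequiv.isLittleO.trans_isBigO hequiv.isBigO_symm
  have hdiff : Tendsto (fun z => ‖y z‖⁻¹ • (y z - A (w z))) l (𝓝 0) :=
    hwy.norm_right.tendsto_inv_smul_nhds_zero
  have hlim : Tendsto (fun z => A (‖y z‖⁻¹ • w z)) l (𝓝 e) := by
    have hsub : Tendsto (fun z => ‖y z‖⁻¹ • y z - ‖y z‖⁻¹ • (y z - A (w z))) l (𝓝 (e - 0)) :=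
      he.sub hdiff
    simpa only [← smul_sub, sub_sub_cancel, sub_zero, ← map_smul] using hsub
  exact (hA.isClosed_range A.uniformContinuous).mem_of_tendsto hlim
    (Eventually.of_forall fun z => mem_range_self _)

end HasUniformStrictFDerivAt

end Parameter

/-! ### The perimeter of a closed polygon -/

theorem eventually_forall_apply_ne {X Y : Type*} [TopologicalSpace X] [TopologicalSpace Y]
    [T2Space Y] {k : ℕ} [NeZero k] {f : ZMod k → X → Y} {x : X} (hf : ∀ i, ContinuousAt (f i) x)
    (hne : ∀ i, f i x ≠ f (i + 1) x) : ∀ᶠ y in 𝓝 x, ∀ i, f i y ≠ f (i + 1) y :=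
  eventually_all.2 fun i => ((hf i).ne_iff_eventually_ne (hf (i + 1))).1 (hne i)

section EdgeDirection

variable {E : Type*} [NormedAddCommGroup E] [NormedSpace ℝ E] {k : ℕ}

/-- The unit vector along the edge of the closed polygon `p` from its `i`-th to its `(i + 1)`-st
vertex, pointing backwards as `direction` does; it is `0` if the edge is degenerate. -/
def edgeDirection (p : ZMod k → E) (i : ZMod k) : E :=
  NormedSpace.normalize (p i - p (i + 1))

theorem norm_edgeDirection {p : ZMod k → E} {i : ZMod k} (hp : p i ≠ p (i + 1)) :
    ‖edgeDirection p i‖ = 1 :=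
  NormedSpace.norm_normalize_eq_one_iff.2 (sub_ne_zero.2 hp)

theorem edgeDirection_rotate (p : ZMod k → E) (c i : ZMod k) :
    edgeDirection (fun i => p (c + i)) i = edgeDirection p (c + i) := by
  rw [edgeDirection, edgeDirection, add_assoc]

theorem edgeDirection_reflect (p : ZMod k → E) (c i : ZMod k) :
    edgeDirection (fun i => p (c - i)) i = -edgeDirection p (c - i - 1) := by
  rw [edgeDirection, edgeDirection, ← NormedSpace.normalize_neg, neg_sub, sub_add_cancel,
    sub_add_eq_sub_sub]

end EdgeDirection

section Perimeter

/-- The perimeter of a closed polygon; `lengthInChart` is its composition with the product of the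
parametrizations of the vertices. -/
def perimeter {E : Type*} [NormedAddCommGroup E] {k : ℕ} [NeZero k] (p : ZMod k → E) : ℝ :=
  ∑ i, ‖p i - p (i + 1)‖

variable {E : Type*} [NormedAddCommGroup E] [InnerProductSpace ℝ E]

theorem hasFDerivAt_norm_of_ne_zero {x : E} (hx : x ≠ 0) :
    HasFDerivAt (fun y : E => ‖y‖) (innerSL ℝ (NormedSpace.normalize x)) x := by
  have hsqrt := (hasStrictFDerivAt_norm_sq x).hasFDerivAt.sqrt (by positivity)
  simp only [Real.sqrt_sq (norm_nonneg _)] at hsqrt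
  refine hsqrt.congr_fderiv ?_
  rw [NormedSpace.normalize, map_smul, ← Nat.cast_smul_eq_nsmul ℝ, smul_smul]
  congr 1
  push_cast
  field_simp

variable {k : ℕ} [NeZero k]

theorem hasFDerivAt_perimeter {p : ZMod k → E} (hp : ∀ i, p i ≠ p (i + 1)) :
    HasFDerivAt perimeter (∑ i, (innerSL ℝ (edgeDirection p i - edgeDirection p (i - 1))).comp
      (ContinuousLinearMap.proj i : (ZMod k → E) →L[ℝ] E)) p := by
  have hsum := HasFDerivAt.fun_sum (u := Finset.univ) fun i (_ : i ∈ Finset.univ) =>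
    (hasFDerivAt_norm_of_ne_zero (sub_ne_zero.2 (hp i))).comp p
      ((hasFDerivAt_apply (𝕜 := ℝ) i p).sub (hasFDerivAt_apply (i + 1) p))
  refine hsum.congr_fderiv (ContinuousLinearMap.ext fun w => ?_)
  simp only [sum_apply, ContinuousLinearMap.comp_apply, sub_apply, innerSL_apply_apply,
    inner_sub_left, inner_sub_right, Finset.sum_sub_distrib, ContinuousLinearMap.proj_apply]
  congr 1
  exact Fintype.sum_equiv (Equiv.addRight 1) _ _ fun i => by
    simp only [edgeDirection, Equiv.coe_addRight, add_sub_cancel_right]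

theorem contDiffAt_perimeter {r : ℕ∞ω} {p : ZMod k → E} (hp : ∀ i, p i ≠ p (i + 1)) :
    ContDiffAt ℝ r perimeter p :=
  ContDiffAt.sum fun i _ =>
    ((contDiff_apply ℝ E i).sub (contDiff_apply ℝ E (i + 1))).contDiffAt.norm ℝ
      (sub_ne_zero.2 (hp i))

section Composition

variable {V : Type*} [NormedAddCommGroup V] [NormedSpace ℝ V] {g : ZMod k → V → E}
  {u : ZMod k → V}

theorem fderiv_perimeter_comp_apply (hg : ∀ i, DifferentiableAt ℝ (g i) (u i))
    (hne : ∀ i, g i (u i) ≠ g (i + 1) (u (i + 1))) (w : ZMod k → V) :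
    fderiv ℝ (perimeter ∘ Pi.map g) u w =
      ∑ i, inner ℝ (edgeDirection (Pi.map g u) i - edgeDirection (Pi.map g u) (i - 1))
        (fderiv ℝ (g i) (u i) (w i)) := by
  have hmap : HasFDerivAt (Pi.map g) (ContinuousLinearMap.piMap fun i => fderiv ℝ (g i) (u i)) u :=
    hasFDerivAt_pi.2 fun i => (hg i).hasFDerivAt.comp u (hasFDerivAt_apply i u)
  rw [((hasFDerivAt_perimeter hne).comp u hmap).fderiv]
  simp only [ContinuousLinearMap.comp_apply, sum_apply, innerSL_apply_apply,
    ContinuousLinearMap.proj_apply, ContinuousLinearMap.coe_piMap', Pi.map_apply]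
  rfl

theorem fderiv_perimeter_comp_single (hg : ∀ i, DifferentiableAt ℝ (g i) (u i))
    (hne : ∀ i, g i (u i) ≠ g (i + 1) (u (i + 1))) (i : ZMod k) (v : V) :
    fderiv ℝ (perimeter ∘ Pi.map g) u (Pi.single i v) =
      inner ℝ (edgeDirection (Pi.map g u) i - edgeDirection (Pi.map g u) (i - 1))
        (fderiv ℝ (g i) (u i) v) := by
  rw [fderiv_perimeter_comp_apply hg hne, Fintype.sum_eq_single i fun j hj => ?_,
    Pi.single_eq_same]
  rw [Pi.single_eq_of_ne hj, map_zero, inner_zero_right]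

theorem fderiv_perimeter_comp_eq_zero_iff (hg : ∀ i, DifferentiableAt ℝ (g i) (u i))
    (hne : ∀ i, g i (u i) ≠ g (i + 1) (u (i + 1))) :
    fderiv ℝ (perimeter ∘ Pi.map g) u = 0 ↔
      ∀ i, edgeDirection (Pi.map g u) i - edgeDirection (Pi.map g u) (i - 1) ∈
        ((fderiv ℝ (g i) (u i)).range)ᗮ := by
  simp only [Submodule.mem_orthogonal', LinearMap.mem_range, forall_exists_index,
    forall_apply_eq_imp_iff, ContinuousLinearMap.coe_coe]
  refine ⟨fun h i v => ?_, fun h => ContinuousLinearMap.ext fun w => ?_⟩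
  · rw [← fderiv_perimeter_comp_single hg hne, h, zero_apply]
  · rw [fderiv_perimeter_comp_apply hg hne, zero_apply]
    exact Finset.sum_eq_zero fun i _ => h i (w i)

end Composition

section Hessian

variable {U V : Type*} [NormedAddCommGroup U] [NormedSpace ℝ U] [NormedAddCommGroup V]
  [NormedSpace ℝ V]

theorem inner_fderiv_eq_zero_of_norm_eq_one {d : U → E} {u : U} (hd : DifferentiableAt ℝ d u)
    (hnorm : ∀ᶠ y in 𝓝 u, ‖d y‖ = 1) (w : U) : inner ℝ (d u) (fderiv ℝ d u w) = 0 := by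
  have hconst : (fun y => inner ℝ (d y) (d y)) =ᶠ[𝓝 u] fun _ => (1 : ℝ) :=
    hnorm.mono fun y hy => (real_inner_self_eq_norm_sq _).trans (by rw [hy, one_pow])
  have hsum := fderiv_inner_apply ℝ hd hd w
  rw [hconst.fderiv_eq, fderiv_fun_const, Pi.zero_apply, zero_apply,
    real_inner_comm (d u) (fderiv ℝ d u w)] at hsum
  linarith

theorem fderiv_inner_sub_eq_zero {a b c : U → E} {u : U} (ha : DifferentiableAt ℝ a u)
    (hb : DifferentiableAt ℝ b u) (hc : DifferentiableAt ℝ c u) (ha1 : ∀ᶠ y in 𝓝 u, ‖a y‖ = 1)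
    (hb1 : ∀ᶠ y in 𝓝 u, ‖b y‖ = 1) (hac : a u = c u) (hbc : b u = c u) :
    fderiv ℝ (fun y => inner ℝ (a y - b y) (c y)) u = 0 := by
  ext w
  have ha0 := inner_fderiv_eq_zero_of_norm_eq_one ha ha1 w
  have hb0 := inner_fderiv_eq_zero_of_norm_eq_one hb hb1 w
  rw [hac, real_inner_comm] at ha0
  rw [hbc, real_inner_comm] at hb0
  rw [fderiv_inner_apply ℝ (ha.fun_sub hb) hc, hac, hbc, sub_self, inner_zero_left, zero_add,
    fderiv_fun_sub ha hb, sub_apply, inner_sub_left, ha0, hb0, sub_zero, zero_apply]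

variable {g : ZMod k → V → E} {u : ZMod k → V}

theorem differentiableAt_edgeDirection (hg : ∀ i, DifferentiableAt ℝ (g i) (u i))
    {i : ZMod k} (hne : g i (u i) ≠ g (i + 1) (u (i + 1))) :
    DifferentiableAt ℝ (fun y => edgeDirection (Pi.map g y) i) u := by
  have hvertex : ∀ j, DifferentiableAt ℝ (fun y : ZMod k → V => g j (y j)) u := fun j =>
    (hg j).comp u (differentiableAt_apply j u)
  have hedge := (hvertex i).fun_sub (hvertex (i + 1))
  exact ((hedge.norm ℝ (sub_ne_zero.2 hne)).fun_inv
    (norm_ne_zero_iff.2 (sub_ne_zero.2 hne))).fun_smul hedge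

/-- The slope of the perimeter along `v` is the inner product of a difference of two unit vectors
with a vector which, at `u`, equals both of them; and the variation of a unit vector is orthogonal
to it. -/
theorem fderiv_fderiv_perimeter_comp_single_eq_zero (hg : ∀ i, ContDiffAt ℝ 2 (g i) (u i))
    (hne : ∀ i, g i (u i) ≠ g (i + 1) (u (i + 1))) {i : ZMod k} {v : V}
    (hstraight : edgeDirection (Pi.map g u) (i - 1) = edgeDirection (Pi.map g u) i)
    (htan : fderiv ℝ (g i) (u i) v = edgeDirection (Pi.map g u) i) :
    fderiv ℝ (fderiv ℝ (perimeter ∘ Pi.map g)) u (Pi.single i v) = 0 := by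
  set l := perimeter ∘ Pi.map g
  have hl : ContDiffAt ℝ 2 l u :=
    (contDiffAt_perimeter hne).comp u <| contDiffAt_pi.2 fun j =>
      (hg j).comp u (contDiff_apply ℝ V j).contDiffAt
  have hl' : DifferentiableAt ℝ (fderiv ℝ l) u :=
    (hl.fderiv_right (m := 1) (by norm_num)).differentiableAt one_ne_zero
  have hgd : ∀ᶠ y in 𝓝 u, ∀ j, DifferentiableAt ℝ (g j) (y j) := eventually_all.2 fun j =>
    (continuousAt_apply j u).eventually (p := (DifferentiableAt ℝ (g j) ·)) <|
      ((hg j).eventually (by simp)).mono fun z hz => hz.differentiableAt two_ne_zero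
  have hev : ∀ᶠ y in 𝓝 u, ∀ j, g j (y j) ≠ g (j + 1) (y (j + 1)) := eventually_forall_apply_ne
    (fun j => ContinuousAt.comp (f := fun y : ZMod k → V => y j) (hg j).continuousAt
      (continuousAt_apply j u)) hne
  have hslope : (fun y => fderiv ℝ l y (Pi.single i v)) =ᶠ[𝓝 u] fun y =>
      inner ℝ (edgeDirection (Pi.map g y) i - edgeDirection (Pi.map g y) (i - 1))
        (fderiv ℝ (g i) (y i) v) := by
    filter_upwards [hgd, hev] with y hy hyne using fderiv_perimeter_comp_single hy hyne i v
  have hg' : DifferentiableAt ℝ (fun y : ZMod k → V => fderiv ℝ (g i) (y i) v) u :=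
    ((((hg i).fderiv_right (m := 1) (by norm_num)).differentiableAt one_ne_zero).comp u
      (differentiableAt_apply i u)).clm_apply (differentiableAt_const v)
  have hslope' : fderiv ℝ (fun y => fderiv ℝ l y (Pi.single i v)) u = 0 := by
    rw [hslope.fderiv_eq]
    refine fderiv_inner_sub_eq_zero (differentiableAt_edgeDirection hgd.self_of_nhds (hne i))
      (differentiableAt_edgeDirection hgd.self_of_nhds (hne (i - 1))) hg'
      (hev.mono fun y hy => norm_edgeDirection (hy i))
      (hev.mono fun y hy => norm_edgeDirection (hy (i - 1))) htan.symm (hstraight.trans htan.symm)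
  rw [fderiv_clm_apply hl' (differentiableAt_const _), fderiv_const_apply] at hslope'
  ext w
  rw [hl.isSymmSndFDerivAt (by simp) (Pi.single i v) w]
  simpa using congrArg (· w) hslope'

end Hessian

end Perimeter

/-! ### Immersions, charts and critical points -/

section Immersion

variable {E E' H G M N : Type*} [NormedAddCommGroup E] [NormedSpace ℝ E] [NormedAddCommGroup E']
  [NormedSpace ℝ E'] [TopologicalSpace H] [TopologicalSpace G] [TopologicalSpace M]
  [ChartedSpace H M] [TopologicalSpace N] [ChartedSpace G N] {I : ModelWithCorners ℝ E H}
  {J : ModelWithCorners ℝ E' G} {f : M → N} {x : M}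

theorem injective_mfderiv_of_eventually_leftInverse {g : N → M}
    (hf : MDifferentiableAt I J f x) (hg : MDifferentiableAt J I g (f x))
    (hgf : ∀ᶠ y in 𝓝 x, g (f y) = y) : Function.Injective (mfderiv I J f x) := by
  have hcomp : mfderiv I I (g ∘ f) x = ContinuousLinearMap.id ℝ (TangentSpace I x) :=
    (EventuallyEq.mfderiv_eq (f := id) hgf).trans mfderiv_id
  rw [mfderiv_comp x hg hf] at hcomp
  exact Function.Injective.of_comp (f := mfderiv J I g (f x)) fun v w hvw =>
    (DFunLike.congr_fun hcomp v).symm.trans (hvw.trans (DFunLike.congr_fun hcomp w))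

theorem exists_mdifferentiableAt_leftInverse_of_isImmersionAt {r : ℕ∞ω} [I.Boundaryless]
    [IsManifold I r M] [IsManifold J r N] (hr : r ≠ 0) (h : Manifold.IsImmersionAt I J r f x) :
    ∃ g : N → M, MDifferentiableAt J I g (f x) ∧ ∀ᶠ y in 𝓝 x, g (f y) = y := by
  set φ := h.domChart.extend I
  set ψ := h.codChart.extend J
  let p : E' →L[ℝ] E :=
    (ContinuousLinearMap.fst ℝ E h.complement).comp (h.equiv.symm : E' →L[ℝ] E × h.complement)
  have hx : x ∈ φ.source := mem_of_mem_nhds (h.domChart.extend_source_mem_nhds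
    h.mem_domChart_source)
  have hp : ∀ y ∈ φ.source, p (ψ (f y)) = φ y := fun y hy => by
    have hwritten : ψ (f (φ.symm (φ y))) = h.equiv (φ y, 0) :=
      h.writtenInCharts (φ.map_source hy)
    rw [φ.left_inv hy] at hwritten
    change (h.equiv.symm (ψ (f y))).1 = φ y
    rw [hwritten, ContinuousLinearEquiv.symm_apply_apply]
  have hψ : MDifferentiableAt J 𝓘(ℝ, E') ψ (f x) :=
    (h.codChart.contMDiffAt_extend (n := r) h.codChart_mem_maximalAtlas
      h.mem_codChart_source).mdifferentiableAt hr
  have hφ : MDifferentiableAt 𝓘(ℝ, E) I φ.symm (p (ψ (f x))) := by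
    refine ((contMDiffOn_extend_symm h.domChart_mem_maximalAtlas).contMDiffAt
      ?_).mdifferentiableAt hr
    rw [← h.domChart.extend_target', hp x hx]
    exact h.domChart.isOpen_extend_target.mem_nhds (φ.map_source hx)
  refine ⟨φ.symm ∘ p ∘ ψ, hφ.comp (f x) (p.mdifferentiableAt.comp (f x) hψ), ?_⟩
  filter_upwards [h.domChart.extend_source_mem_nhds (I := I) h.mem_domChart_source] with y hy
  exact (congrArg φ.symm (hp y hy)).trans (φ.left_inv hy)

theorem injective_mfderiv_of_isImmersionAt {r : ℕ∞ω} [I.Boundaryless] [IsManifold I r M]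
    [IsManifold J r N] (hr : r ≠ 0) (h : Manifold.IsImmersionAt I J r f x) :
    Function.Injective (mfderiv I J f x) :=
  let ⟨_, hg, hgf⟩ := exists_mdifferentiableAt_leftInverse_of_isImmersionAt hr h
  injective_mfderiv_of_eventually_leftInverse (h.contMDiffAt.mdifferentiableAt hr) hg hgf

end Immersion

section Charts

variable {E H W M : Type*} [NormedAddCommGroup E] [NormedSpace ℝ E] [TopologicalSpace H]
  [NormedAddCommGroup W] [NormedSpace ℝ W] [TopologicalSpace M] [ChartedSpace H M]

/-- The image of the tangent space at `p` under the differential of `f`, that is, the tangent space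
of `f(M)` at `f p` when `f` is an embedding. -/
def tangentImage (I : ModelWithCorners ℝ E H) (f : M → W) (p : M) : Submodule ℝ W :=
  (mfderiv I 𝓘(ℝ, W) f p).range

variable {I : ModelWithCorners ℝ E H} [I.Boundaryless] {f : M → W} {p : M} {u : E}

theorem contMDiffAt_extChartAt_symm {r : ℕ∞ω} [IsManifold I r M]
    (hu : u ∈ (extChartAt I p).target) : ContMDiffAt 𝓘(ℝ, E) I r (extChartAt I p).symm u :=
  (contMDiffOn_extChartAt_symm p).contMDiffAt ((isOpen_extChartAt_target p).mem_nhds hu)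

variable [IsManifold I 1 M]

theorem differentiableAt_comp_extChartAt_symm (hu : u ∈ (extChartAt I p).target)
    (hf : MDifferentiableAt I 𝓘(ℝ, W) f ((extChartAt I p).symm u)) :
    DifferentiableAt ℝ (f ∘ (extChartAt I p).symm) u :=
  (hf.comp u ((contMDiffAt_extChartAt_symm hu).mdifferentiableAt one_ne_zero)).differentiableAt

theorem fderiv_comp_extChartAt_symm (hu : u ∈ (extChartAt I p).target)
    (hf : MDifferentiableAt I 𝓘(ℝ, W) f ((extChartAt I p).symm u)) :
    fderiv ℝ (f ∘ (extChartAt I p).symm) u = (mfderiv I 𝓘(ℝ, W) f ((extChartAt I p).symm u)).comp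
      (mfderiv 𝓘(ℝ, E) I (extChartAt I p).symm u) := by
  rw [← mfderiv_eq_fderiv,
    mfderiv_comp u hf ((contMDiffAt_extChartAt_symm hu).mdifferentiableAt one_ne_zero)]

theorem isInvertible_mfderiv_extChartAt_symm (hu : u ∈ (extChartAt I p).target) :
    (mfderiv 𝓘(ℝ, E) I (extChartAt I p).symm u).IsInvertible := by
  have hinv := isInvertible_mfderivWithin_extChartAt_symm (I := I) hu
  rwa [I.range_eq_univ, mfderivWithin_univ] at hinv

theorem range_fderiv_comp_extChartAt_symm (hu : u ∈ (extChartAt I p).target)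
    (hf : MDifferentiableAt I 𝓘(ℝ, W) f ((extChartAt I p).symm u)) :
    (fderiv ℝ (f ∘ (extChartAt I p).symm) u).range =
      tangentImage I f ((extChartAt I p).symm u) := by
  rw [fderiv_comp_extChartAt_symm hu hf]
  exact LinearMap.range_comp_of_range_eq_top _
    (LinearMap.range_eq_top.2 (isInvertible_mfderiv_extChartAt_symm hu).surjective)

theorem injective_fderiv_comp_extChartAt_symm (hu : u ∈ (extChartAt I p).target)
    (hf : MDifferentiableAt I 𝓘(ℝ, W) f ((extChartAt I p).symm u))
    (himm : Function.Injective (mfderiv I 𝓘(ℝ, W) f ((extChartAt I p).symm u))) :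
    Function.Injective (fderiv ℝ (f ∘ (extChartAt I p).symm) u) := by
  rw [fderiv_comp_extChartAt_symm hu hf]
  exact himm.comp (isInvertible_mfderiv_extChartAt_symm hu).injective

end Charts

section Trajectories

variable {n m k : ℕ} {M : Type*} [TopologicalSpace M] [ChartedSpace (EuclideanSpace ℝ (Fin m)) M]
  {f : M → EuclideanSpace ℝ (Fin n)} {x : ZMod k → M}

theorem isClosedTrajectory_iff : IsClosedTrajectory (m := m) f x ↔ (∀ i, x i ≠ x (i + 1)) ∧
    ∀ i, edgeDirection (f ∘ x) i - edgeDirection (f ∘ x) (i - 1) ∈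
      (tangentImage (𝓡 m) f (x i))ᗮ := by
  refine and_congr_right fun _ => forall_congr' fun i => ?_
  rw [Submodule.mem_orthogonal', edgeDirection, edgeDirection, sub_add_cancel]
  exact ⟨fun h _ ⟨v, hv⟩ => hv ▸ h v, fun h v => h _ ⟨v, rfl⟩⟩

/-- The product chart of `M ^ k` centred at `x`. -/
def productChart (x : ZMod k → M) : (ZMod k → M) → ZMod k → EuclideanSpace ℝ (Fin m) :=
  Pi.map fun i => extChartAt (𝓡 m) (x i)

/-- The inverse of the product chart of `M ^ k` centred at `x`. -/
def productChartSymm (x : ZMod k → M) : (ZMod k → EuclideanSpace ℝ (Fin m)) → ZMod k → M :=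
  Pi.map fun i => (extChartAt (𝓡 m) (x i)).symm

theorem productChartSymm_coords : productChartSymm x (coords (m := m) x) = x :=
  funext fun i => extChartAt_to_inv (I := 𝓡 m) (x i)

theorem coords_mem_target (i : ZMod k) : coords (m := m) x i ∈ (extChartAt (𝓡 m) (x i)).target :=
  mem_extChartAt_target (x i)

theorem continuousAt_productChart : ContinuousAt (productChart (m := m) x) x :=
  .piMap fun i => continuousAt_extChartAt (x i)

theorem continuousAt_productChartSymm :
    ContinuousAt (productChartSymm x) (coords (m := m) x) :=
  .piMap fun i => continuousAt_extChartAt_symm (x i)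

variable [NeZero k]

theorem eventually_productChartSymm_productChart :
    ∀ᶠ y in 𝓝 x, productChartSymm x (productChart (m := m) x y) = y := by
  have hsource : ∀ᶠ y in 𝓝 x, ∀ i, y i ∈ (extChartAt (𝓡 m) (x i)).source := eventually_all.2
    fun i => (continuousAt_apply i x).eventually (extChartAt_source_mem_nhds (x i))
  exact hsource.mono fun y hy => funext fun i => (extChartAt (𝓡 m) (x i)).left_inv (hy i)

theorem lengthInChart_eq_perimeter_comp : lengthInChart (m := m) f x =
    perimeter ∘ Pi.map fun i => f ∘ (extChartAt (𝓡 m) (x i)).symm :=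
  rfl

theorem fderiv_lengthInChart_eq_zero_iff [IsManifold (𝓡 m) 1 M]
    (hf : MDifferentiable (𝓡 m) 𝓘(ℝ, EuclideanSpace ℝ (Fin n)) f)
    {u : ZMod k → EuclideanSpace ℝ (Fin m)} (hu : ∀ i, u i ∈ (extChartAt (𝓡 m) (x i)).target)
    (hne : ∀ i, f (productChartSymm x u i) ≠ f (productChartSymm x u (i + 1))) :
    fderiv ℝ (lengthInChart (m := m) f x) u = 0 ↔
      IsClosedTrajectory (m := m) f (productChartSymm x u) := by
  rw [isClosedTrajectory_iff, and_iff_right fun i => ne_of_apply_ne f (hne i),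
    lengthInChart_eq_perimeter_comp, fderiv_perimeter_comp_eq_zero_iff
      (fun i => differentiableAt_comp_extChartAt_symm (hu i) (hf _)) hne]
  refine forall_congr' fun i => ?_
  rw [range_fderiv_comp_extChartAt_symm (hu i) (hf _)]
  rfl

theorem isCriticalPoint_iff_isClosedTrajectory [IsManifold (𝓡 m) 1 M]
    (hf : MDifferentiable (𝓡 m) 𝓘(ℝ, EuclideanSpace ℝ (Fin n)) f)
    (hne : ∀ i, f (x i) ≠ f (x (i + 1))) :
    IsCriticalPoint (m := m) f x ↔ IsClosedTrajectory (m := m) f x := by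
  rw [IsCriticalPoint, fderiv_lengthInChart_eq_zero_iff hf coords_mem_target
    (by rwa [productChartSymm_coords]), productChartSymm_coords]

theorem LengthIsMorse.edgeDirection_notMem_tangentImage [IsManifold (𝓡 m) 2 M]
    (hmorse : LengthIsMorse (m := m) f k)
    (hf : ContMDiff (𝓡 m) 𝓘(ℝ, EuclideanSpace ℝ (Fin n)) 2 f) (hinj : Function.Injective f)
    (hx : IsClosedTrajectory (m := m) f x) {i : ZMod k}
    (hstraight : edgeDirection (f ∘ x) (i - 1) = edgeDirection (f ∘ x) i) :
    edgeDirection (f ∘ x) i ∉ tangentImage (𝓡 m) f (x i) := by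
  intro htan
  have : IsManifold (𝓡 m) 1 M := IsManifold.of_le one_le_two
  have hfd := hf.mdifferentiable two_ne_zero
  have hne : ∀ j, f (x j) ≠ f (x (j + 1)) := fun j => hinj.ne (hx.1 j)
  have hmap : Pi.map (fun j => f ∘ (extChartAt (𝓡 m) (x j)).symm) (coords (m := m) x) = f ∘ x :=
    congrArg (f ∘ ·) productChartSymm_coords
  obtain ⟨v, hv⟩ : edgeDirection (f ∘ x) i ∈
      (fderiv ℝ (f ∘ (extChartAt (𝓡 m) (x i)).symm) (coords (m := m) x i)).range := by
    rw [range_fderiv_comp_extChartAt_symm (coords_mem_target i) (hfd _)]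
    rwa [coords, extChartAt_to_inv]
  have hkernel : fderiv ℝ (fderiv ℝ (lengthInChart (m := m) f x)) (coords x) (Pi.single i v) = 0 :=
    fderiv_fderiv_perimeter_comp_single_eq_zero
      (fun j => (hf.contMDiffAt.comp _
        (contMDiffAt_extChartAt_symm (coords_mem_target j))).contDiffAt)
      (fun j => by simpa only [Function.comp_apply, coords, extChartAt_to_inv] using hne j)
      (by rwa [hmap]) (by rwa [hmap])
  have hsingle : Pi.single i v = (0 : ZMod k → EuclideanSpace ℝ (Fin m)) :=
    hmorse x hx.1 ((isCriticalPoint_iff_isClosedTrajectory hfd hne).2 hx) _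
      fun w => by rw [hkernel, zero_apply]
  have hv0 : v = 0 := by simpa only [Pi.single_eq_zero_iff] using hsingle
  have hunit := norm_edgeDirection (p := f ∘ x) (hne i)
  rw [← hv, hv0, map_zero, norm_zero] at hunit
  exact zero_ne_one hunit

end Trajectories

/-! ### Continuation of nondegenerate trajectories -/

section Families

variable {E' G' N V W : Type*} [NormedAddCommGroup E'] [NormedSpace ℝ E'] [TopologicalSpace G']
  {J : ModelWithCorners ℝ E' G'} [TopologicalSpace N] [ChartedSpace G' N]
  [NormedAddCommGroup V] [NormedSpace ℝ V] [NormedAddCommGroup W] [NormedSpace ℝ W]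
  {L : N → V → W} {t₀ : N} {u₀ : V} {r s : ℕ∞ω}

theorem contMDiffAt_partial_fderiv [IsManifold J 1 N] (hs : s + 1 ≤ r)
    (h : ContMDiffAt (J.prod 𝓘(ℝ, V)) 𝓘(ℝ, W) r (Function.uncurry L) (t₀, u₀)) :
    ContMDiffAt (J.prod 𝓘(ℝ, V)) 𝓘(ℝ, V →L[ℝ] W) s
      (Function.uncurry fun t => fderiv ℝ (L t)) (t₀, u₀) := by
  have hL : ContMDiffAt ((J.prod 𝓘(ℝ, V)).prod 𝓘(ℝ, V)) 𝓘(ℝ, W) r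
      (Function.uncurry fun q : N × V => L q.1) ((t₀, u₀), u₀) :=
    h.comp (f := fun z : (N × V) × V => (z.1.1, z.2)) ((t₀, u₀), u₀)
      ((contMDiffAt_fst.comp _ contMDiffAt_fst).prodMk contMDiffAt_snd)
  have hL' := ContMDiffAt.mfderiv (x₀ := (t₀, u₀)) (fun q : N × V => L q.1) Prod.snd hL
    contMDiffAt_snd hs
  simp only [mfderiv_eq_fderiv] at hL'
  rwa [inTangentCoordinates_model_space (I := 𝓘(ℝ, V)) (I' := 𝓘(ℝ, W)) Prod.snd
    (fun q : N × V => L q.1 q.2) (fun q => fderiv ℝ (L q.1) q.2) (t₀, u₀)] at hL'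

theorem hasUniformStrictFDerivAt_of_contMDiffAt [IsManifold J 1 N]
    (h : ContMDiffAt (J.prod 𝓘(ℝ, V)) 𝓘(ℝ, W) 1 (Function.uncurry L) (t₀, u₀)) :
    HasUniformStrictFDerivAt L (fderiv ℝ (L t₀) u₀) t₀ u₀ := by
  have hdiff : ∀ᶠ p in 𝓝 (t₀, u₀), HasFDerivAt (L p.1) (fderiv ℝ (L p.1) p.2) p.2 := by
    filter_upwards [(contMDiffAt_iff_contMDiffAt_nhds (by simp)).1 h] with p hp
    exact (hp.curry_right.mdifferentiableAt one_ne_zero).differentiableAt.hasFDerivAt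
  exact hasUniformStrictFDerivAt_of_continuousAt hdiff
    (contMDiffAt_partial_fderiv (s := 0) (by simp) h).continuousAt

variable {E H M : Type*} [NormedAddCommGroup E] [NormedSpace ℝ E] [TopologicalSpace H]
  {I : ModelWithCorners ℝ E H} [I.Boundaryless] [TopologicalSpace M] [ChartedSpace H M]
  [IsManifold I r M] {F : M × N → W} {p : M} {u : E}

theorem contMDiffAt_family_comp_extChartAt_symm (hF : ContMDiff (I.prod J) 𝓘(ℝ, W) r F)
    (hu : u ∈ (extChartAt I p).target) :
    ContMDiffAt (J.prod 𝓘(ℝ, E)) 𝓘(ℝ, W) r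
      (Function.uncurry fun t => (fun p => F (p, t)) ∘ (extChartAt I p).symm) (t₀, u) :=
  hF.contMDiffAt.comp (t₀, u)
    (((contMDiffAt_extChartAt_symm hu).comp (t₀, u) contMDiffAt_snd).prodMk contMDiffAt_fst)

end Families

theorem exists_continuousLinearEquiv_dual {V : Type*} [NormedAddCommGroup V] [NormedSpace ℝ V]
    [FiniteDimensional ℝ V] (B : V →L[ℝ] V →L[ℝ] ℝ) (hB : ∀ v, (∀ w, B v w = 0) → v = 0) :
    ∃ e : V ≃L[ℝ] (V →L[ℝ] ℝ), (e : V →L[ℝ] V →L[ℝ] ℝ) = B := by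
  have hinj : Function.Injective (B : V →ₗ[ℝ] V →L[ℝ] ℝ) :=
    (injective_iff_map_eq_zero _).2 fun v hv => hB v fun w => DFunLike.congr_fun hv w
  have hdim : Module.finrank ℝ V = Module.finrank ℝ (V →L[ℝ] ℝ) := by
    rw [← (LinearMap.toContinuousLinearMap (𝕜 := ℝ) (E := V) (F' := ℝ)).finrank_eq]
    exact Subspace.dual_finrank_eq.symm
  exact ⟨(LinearMap.linearEquivOfInjective _ hinj hdim).toContinuousLinearEquiv, rfl⟩

section Continuation

variable {n m k : ℕ} [NeZero k] {E' G' M N : Type*} [NormedAddCommGroup E'] [NormedSpace ℝ E']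
  [TopologicalSpace G'] {J : ModelWithCorners ℝ E' G'} [TopologicalSpace N] [ChartedSpace G' N]
  [TopologicalSpace M] [ChartedSpace (EuclideanSpace ℝ (Fin m)) M]
  {F : M × N → EuclideanSpace ℝ (Fin n)} {x : ZMod k → M} {t₀ : N}

theorem contMDiffAt_vertex {r : ℕ∞ω} [IsManifold (𝓡 m) r M]
    (hF : ContMDiff ((𝓡 m).prod J) 𝓘(ℝ, EuclideanSpace ℝ (Fin n)) r F) (i : ZMod k) :
    ContMDiffAt (J.prod 𝓘(ℝ, ZMod k → EuclideanSpace ℝ (Fin m)))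
      𝓘(ℝ, EuclideanSpace ℝ (Fin n)) r
      (fun q => F (productChartSymm x q.2 i, q.1)) (t₀, coords (m := m) x) :=
  ContMDiffAt.comp (t₀, coords (m := m) x) (I' := J.prod 𝓘(ℝ, EuclideanSpace ℝ (Fin m)))
    (f := fun q : N × (ZMod k → EuclideanSpace ℝ (Fin m)) => (q.1, q.2 i))
    (contMDiffAt_family_comp_extChartAt_symm hF (coords_mem_target i))
    (contMDiffAt_fst.prodMk (contMDiffAt_pi_space.1 contMDiffAt_snd i))

theorem contMDiffAt_lengthInChart {r : ℕ∞ω} [IsManifold (𝓡 m) r M]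
    (hF : ContMDiff ((𝓡 m).prod J) 𝓘(ℝ, EuclideanSpace ℝ (Fin n)) r F)
    (hne : ∀ i, F (x i, t₀) ≠ F (x (i + 1), t₀)) :
    ContMDiffAt (J.prod 𝓘(ℝ, ZMod k → EuclideanSpace ℝ (Fin m))) 𝓘(ℝ, ℝ) r
      (Function.uncurry fun t => lengthInChart (m := m) (fun p => F (p, t)) x)
      (t₀, coords (m := m) x) := by
  refine (contDiffAt_perimeter ?_).contMDiffAt.comp _
    (contMDiffAt_pi_space.2 (contMDiffAt_vertex hF))
  simpa only [coords, extChartAt_to_inv] using hne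

variable [IsManifold (𝓡 m) 2 M]
  (hF : ContMDiff ((𝓡 m).prod J) 𝓘(ℝ, EuclideanSpace ℝ (Fin n)) 2 F)
include hF

theorem contMDiffAt_fderiv_lengthInChart [IsManifold J 1 N]
    (hne : ∀ i, F (x i, t₀) ≠ F (x (i + 1), t₀)) :
    ContMDiffAt (J.prod 𝓘(ℝ, ZMod k → EuclideanSpace ℝ (Fin m)))
      𝓘(ℝ, (ZMod k → EuclideanSpace ℝ (Fin m)) →L[ℝ] ℝ) 1
      (Function.uncurry fun t => fderiv ℝ (lengthInChart (m := m) (fun p => F (p, t)) x))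
      (t₀, coords (m := m) x) :=
  contMDiffAt_partial_fderiv (by norm_num) (contMDiffAt_lengthInChart hF hne)

theorem eventually_fderiv_lengthInChart_eq_zero_iff
    (hne : ∀ i, F (x i, t₀) ≠ F (x (i + 1), t₀)) :
    ∀ᶠ q in 𝓝 (t₀, coords (m := m) x),
      fderiv ℝ (lengthInChart (m := m) (fun p => F (p, q.1)) x) q.2 = 0 ↔
        productChartSymm x q.2 ∈ trajectories (m := m) (fun p => F (p, q.1)) k := by
  have hM : IsManifold (𝓡 m) 1 M := IsManifold.of_le one_le_two
  have htarget : ∀ᶠ q in 𝓝 (t₀, coords (m := m) x), ∀ i,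
      q.2 i ∈ (extChartAt (𝓡 m) (x i)).target := eventually_all.2 fun i =>
    ((continuous_apply i).comp continuous_snd).continuousAt.eventually
      ((isOpen_extChartAt_target (x i)).mem_nhds (coords_mem_target i))
  have hdistinct := eventually_forall_apply_ne
    (fun i => (contMDiffAt_vertex (t₀ := t₀) (x := x) hF i).continuousAt)
    (by simpa only [productChartSymm_coords] using hne)
  filter_upwards [htarget, hdistinct] with q hq hqne
  exact fderiv_lengthInChart_eq_zero_iff
    ((hF.comp (contMDiff_id.prodMk contMDiff_const)).mdifferentiable two_ne_zero) hq hqne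

theorem persistsUniquely_trajectories [IsManifold J 1 N]
    (hinj : Function.Injective fun p => F (p, t₀))
    (hx : x ∈ trajectories (m := m) (fun p => F (p, t₀)) k)
    (hnd : HasNondegenerateHessian (m := m) (fun p => F (p, t₀)) x) :
    PersistsUniquely (fun t => trajectories (m := m) (fun p => F (p, t)) k) t₀ x := by
  have hC1 := contMDiffAt_fderiv_lengthInChart hF fun i => hinj.ne (hx.1 i)
  have hiff := eventually_fderiv_lengthInChart_eq_zero_iff hF fun i => hinj.ne (hx.1 i)
  obtain ⟨P, hP, Q, hQ, hPQ⟩ := eventually_prod_iff.1 (hiff.filter_mono nhds_prod_eq.ge)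
  obtain ⟨e, he⟩ := exists_continuousLinearEquiv_dual _ hnd
  have hstrict := he ▸ hasUniformStrictFDerivAt_of_contMDiffAt hC1
  refine ⟨fun U hU => ?_, ?_⟩
  · have hnhds : {u | Q u} ∩ productChartSymm x ⁻¹' U ∈ 𝓝 (coords (m := m) x) := inter_mem hQ
      (continuousAt_productChartSymm.preimage_mem_nhds (by rwa [productChartSymm_coords]))
    have hzero := hstrict.eventually_exists_zero
      (hC1.continuousAt.comp (f := (·, coords x)) (by fun_prop))
      (hiff.self_of_nhds.2 (by rwa [productChartSymm_coords])) hnhds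
    filter_upwards [hP, hzero] with t ht ⟨u, ⟨hu, huU⟩, hu0⟩
    exact ⟨_, huU, (hPQ ht hu).1 hu0⟩
  · obtain ⟨s, hs, hinjOn⟩ := hstrict.exists_eventually_injOn
    refine ⟨_, inter_mem (eventually_productChartSymm_productChart (m := m))
      (continuousAt_productChart (inter_mem hQ hs)), ?_⟩
    filter_upwards [hP, hinjOn] with t ht hinjOn
    rintro y ⟨⟨hy, hyQ, hys⟩, hyt⟩ z ⟨⟨hz, hzQ, hzs⟩, hzt⟩
    rw [← hy, ← hz]
    exact congrArg _ (hinjOn hys hzs (((hPQ ht hyQ).2 (hy.symm ▸ hyt)).trans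
      ((hPQ ht hzQ).2 (hz.symm ▸ hzt)).symm))

end Continuation

/-! ### Polygons with collapsed edges -/

section SkipLast

variable {j : ℕ}

/-- The inclusion of the labels of a polygon with one vertex less; it leaves out the label `-1`. -/
def skipLast : ZMod (j + 1) → ZMod (j + 2) :=
  Fin.castSucc (n := j + 1)

theorem skipLast_zero : skipLast (0 : ZMod (j + 1)) = 0 :=
  rfl

theorem last_eq_neg_one : Fin.last j = (-1 : ZMod (j + 1)) :=
  eq_neg_of_add_eq_zero_left (Fin.last_add_one j)

theorem skipLast_add_one {a : ZMod (j + 1)} (ha : a ≠ -1) : skipLast (a + 1) = skipLast a + 1 := by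
  obtain ⟨i, rfl⟩ := Fin.exists_castSucc_eq.2 fun h => ha (h.trans last_eq_neg_one)
  exact (congrArg Fin.castSucc Fin.coeSucc_eq_succ).trans
    ((Fin.succ_castSucc i).symm.trans Fin.coeSucc_eq_succ.symm)

theorem skipLast_neg_one : skipLast (-1 : ZMod (j + 1)) = -1 - 1 := by
  have hsucc : Fin.castSucc (Fin.last j) + 1 = Fin.last (j + 1) :=
    Fin.coeSucc_eq_succ.trans (Fin.succ_last j)
  exact eq_sub_of_add_eq ((congrArg (skipLast · + 1) last_eq_neg_one.symm).trans
    (hsucc.trans last_eq_neg_one))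

theorem skipLast_sub_one {a : ZMod (j + 1)} (ha : a ≠ 0) : skipLast (a - 1) = skipLast a - 1 := by
  have ha' : a - 1 ≠ -1 := fun h => ha (by rwa [sub_eq_neg_self] at h)
  rw [eq_sub_iff_add_eq, ← skipLast_add_one ha', sub_add_cancel]

theorem exists_skipLast_eq {i : ZMod (j + 2)} (hi : i ≠ -1) : ∃ a, skipLast a = i :=
  Fin.exists_castSucc_eq.2 fun h => hi (h.trans last_eq_neg_one)

variable {M : Type*} {x : ZMod (j + 2) → M}

theorem apply_skipLast_add_one (hlast : x (-1) = x 0) (a : ZMod (j + 1)) :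
    x (skipLast (a + 1)) = x (skipLast a + 1) := by
  rcases eq_or_ne a (-1) with rfl | ha
  · rw [neg_add_cancel, skipLast_neg_one, sub_add_cancel, skipLast_zero, hlast]
  · rw [skipLast_add_one ha]

theorem exists_apply_skipLast_ne (hlast : x (-1) = x 0) (hne : ∃ i, x i ≠ x (i + 1)) :
    ∃ a, x (skipLast a) ≠ x (skipLast (a + 1)) := by
  obtain ⟨i, hi⟩ := hne
  obtain ⟨a, rfl⟩ := exists_skipLast_eq (i := i) fun h => hi (by rwa [h, neg_add_cancel])
  exact ⟨a, by rwa [apply_skipLast_add_one hlast]⟩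

end SkipLast

section LimitPolygons

theorem eq_of_inner_sub_eq_zero {W : Type*} [NormedAddCommGroup W] [InnerProductSpace ℝ W]
    {a b : W} (ha : ‖a‖ = 1) (hb : ‖b‖ = 1) (h : inner ℝ (a - b) a = 0) : b = a := by
  rw [inner_sub_left, real_inner_self_eq_norm_sq, ha] at h
  exact (inner_eq_one_iff_of_norm_eq_one (𝕜 := ℝ) hb ha).1 (by linarith)

variable {E H W M : Type*} [NormedAddCommGroup E] [NormedSpace ℝ E] [TopologicalSpace H]
  [NormedAddCommGroup W] [InnerProductSpace ℝ W] [TopologicalSpace M] [ChartedSpace H M]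

/-- A limit of closed billiard trajectories: a closed polygon `x`, possibly with collapsed edges,
with unit vectors `e` that satisfy the reflection law, are the directions of the edges that are not
collapsed, and are tangent to `f(M)` at the collapsed ones. -/
structure IsLimitPolygon (I : ModelWithCorners ℝ E H) (f : M → W) {k : ℕ} (x : ZMod k → M)
    (e : ZMod k → W) : Prop where
  norm_eq_one : ∀ i, ‖e i‖ = 1
  eq_edgeDirection : ∀ i, x i ≠ x (i + 1) → e i = edgeDirection (f ∘ x) i
  mem_tangentImage : ∀ i, x i = x (i + 1) → e i ∈ tangentImage I f (x i)
  reflection : ∀ i, e i - e (i - 1) ∈ (tangentImage I f (x i))ᗮ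

/-- At its `i`-th vertex the polygon goes straight on, in a direction tangent to `f(M)`. -/
def IsStraightTangentVertex (I : ModelWithCorners ℝ E H) (f : M → W) {k : ℕ} (x : ZMod k → M)
    (e : ZMod k → W) (i : ZMod k) : Prop :=
  e (i - 1) = e i ∧ e i ∈ tangentImage I f (x i)

namespace IsLimitPolygon

variable {I : ModelWithCorners ℝ E H} {f : M → W} {k : ℕ} {x : ZMod k → M} {e : ZMod k → W}

theorem straight_of_collapsed (h : IsLimitPolygon I f x e) {i : ZMod k} (hi : x i = x (i + 1)) :
    IsStraightTangentVertex I f x e i :=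
  have htan := h.mem_tangentImage i hi
  ⟨eq_of_inner_sub_eq_zero (h.norm_eq_one _) (h.norm_eq_one _)
    ((Submodule.mem_orthogonal' _ _).1 (h.reflection i) _ htan), htan⟩

theorem straight_succ_of_collapsed (h : IsLimitPolygon I f x e) {i : ZMod k}
    (hi : x i = x (i + 1)) : IsStraightTangentVertex I f x e (i + 1) := by
  have htan : e i ∈ tangentImage I f (x (i + 1)) := hi ▸ h.mem_tangentImage i hi
  have hinner := (Submodule.mem_orthogonal' _ _).1 (h.reflection (i + 1)) _ htan
  rw [add_sub_cancel_right, ← neg_sub, inner_neg_left, neg_eq_zero] at hinner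
  have heq : e (i + 1) = e i :=
    eq_of_inner_sub_eq_zero (h.norm_eq_one _) (h.norm_eq_one _) hinner
  exact ⟨by rw [add_sub_cancel_right, heq], heq ▸ htan⟩

theorem apply_eq_apply_zero [NeZero k] (h : IsLimitPolygon I f x e)
    (hcollapsed : ∀ i, x i = x (i + 1)) (i : ZMod k) : e i = e 0 := by
  have hcast (j : ℕ) : e (j : ZMod k) = e 0 := by
    induction j with
    | zero => rw [Nat.cast_zero]
    | succ j ih =>
      rw [← ih, Nat.cast_succ, ← (h.straight_succ_of_collapsed (hcollapsed j)).1,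
        add_sub_cancel_right]
  rw [← ZMod.natCast_zmod_val i]
  exact hcast _

theorem relabel (h : IsLimitPolygon I f x e) {j : ℕ} {σ : ZMod j → ZMod k}
    (hx : ∀ a, x (σ (a + 1)) = x (σ a + 1)) (he : ∀ a, e (σ (a - 1)) = e (σ a - 1)) :
    IsLimitPolygon I f (x ∘ σ) (e ∘ σ) where
  norm_eq_one a := h.norm_eq_one (σ a)
  eq_edgeDirection a ha := by
    simp only [Function.comp_apply, hx] at ha
    simp only [edgeDirection, Function.comp_apply, hx]
    exact h.eq_edgeDirection (σ a) ha
  mem_tangentImage a ha := h.mem_tangentImage (σ a) (ha.trans (hx a))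
  reflection a := by
    simp only [Function.comp_apply, he]
    exact h.reflection (σ a)

theorem rotate (h : IsLimitPolygon I f x e) (c : ZMod k) :
    IsLimitPolygon I f (fun i => x (i + c)) (fun i => e (i + c)) :=
  h.relabel (fun _ => by rw [add_right_comm]) fun _ => by rw [sub_add_eq_add_sub]

section DeleteLast

variable {j : ℕ} {x : ZMod (j + 2) → M} {e : ZMod (j + 2) → W}

theorem apply_skipLast_sub_one (h : IsLimitPolygon I f x e) (hlast : x (-1) = x 0)
    (a : ZMod (j + 1)) : e (skipLast (a - 1)) = e (skipLast a - 1) := by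
  rcases eq_or_ne a 0 with rfl | ha
  · rw [zero_sub, skipLast_neg_one, skipLast_zero, zero_sub]
    exact (h.straight_of_collapsed (by rwa [neg_add_cancel])).1
  · rw [skipLast_sub_one ha]

theorem deleteLast (h : IsLimitPolygon I f x e) (hlast : x (-1) = x 0) :
    IsLimitPolygon I f (x ∘ skipLast) (e ∘ skipLast) :=
  h.relabel (apply_skipLast_add_one hlast) (h.apply_skipLast_sub_one hlast)

theorem straight_deleteLast (h : IsLimitPolygon I f x e) (hlast : x (-1) = x 0) :
    IsStraightTangentVertex I f (x ∘ skipLast) (e ∘ skipLast) 0 := by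
  have hstraight := h.straight_succ_of_collapsed (i := -1) (by rwa [neg_add_cancel])
  rw [neg_add_cancel] at hstraight
  exact ⟨(h.apply_skipLast_sub_one hlast 0).trans hstraight.1, hstraight.2⟩

end DeleteLast

end IsLimitPolygon

end LimitPolygons

section GenericLimitPolygons

variable {n m k : ℕ} {M : Type*} [TopologicalSpace M] [ChartedSpace (EuclideanSpace ℝ (Fin m)) M]
  {f : M → EuclideanSpace ℝ (Fin n)}

namespace IsLimitPolygon

theorem isClosedTrajectory {x : ZMod k → M} {e : ZMod k → EuclideanSpace ℝ (Fin n)}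
    (h : IsLimitPolygon (𝓡 m) f x e) (hne : ∀ i, x i ≠ x (i + 1)) :
    IsClosedTrajectory (m := m) f x := by
  refine isClosedTrajectory_iff.2 ⟨hne, fun i => ?_⟩
  rw [← h.eq_edgeDirection i (hne i), ← h.eq_edgeDirection (i - 1) (hne (i - 1))]
  exact h.reflection i

variable [IsManifold (𝓡 m) 2 M]

theorem not_isStraightTangentVertex_of_forall_ne [NeZero k] {x : ZMod k → M}
    {e : ZMod k → EuclideanSpace ℝ (Fin n)} (hmorse : LengthIsMorse (m := m) f k)
    (hf : ContMDiff (𝓡 m) 𝓘(ℝ, EuclideanSpace ℝ (Fin n)) 2 f) (hinj : Function.Injective f)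
    (h : IsLimitPolygon (𝓡 m) f x e) (hne : ∀ i, x i ≠ x (i + 1)) (i : ZMod k) :
    ¬ IsStraightTangentVertex (𝓡 m) f x e i := by
  rintro ⟨hstraight, htan⟩
  rw [h.eq_edgeDirection i (hne i)] at hstraight htan
  rw [h.eq_edgeDirection (i - 1) (hne (i - 1))] at hstraight
  exact hmorse.edgeDirection_notMem_tangentImage hf hinj (h.isClosedTrajectory hne) hstraight htan

/-- Deleting a collapsed edge leaves a straight tangent vertex behind. After all the collapsed
edges are gone, such a vertex makes the Hessian of the length degenerate. -/
theorem not_isStraightTangentVertex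
    (hf : ContMDiff (𝓡 m) 𝓘(ℝ, EuclideanSpace ℝ (Fin n)) 2 f) (hinj : Function.Injective f)
    (hgen : IsGenericUpTo (m := m) f k) {j : ℕ} (hj : j + 1 ≤ k) {x : ZMod (j + 1) → M}
    {e : ZMod (j + 1) → EuclideanSpace ℝ (Fin n)} (h : IsLimitPolygon (𝓡 m) f x e)
    (hne : ∃ i, x i ≠ x (i + 1)) (i : ZMod (j + 1)) :
    ¬ IsStraightTangentVertex (𝓡 m) f x e i := by
  induction j with
  | zero =>
    obtain ⟨i, hi⟩ := hne
    exact absurd (congrArg x (Subsingleton.elim (α := Fin 1) _ _)) hi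
  | succ j ih =>
    by_cases hall : ∀ i, x i ≠ x (i + 1)
    · exact not_isStraightTangentVertex_of_forall_ne (hgen (j + 2) (by omega) hj) hf hinj h hall i
    push Not at hall
    obtain ⟨l, hl⟩ := hall
    have hlast : x (-1 + (l + 1)) = x (0 + (l + 1)) := by simpa using hl
    have hne' : ∃ i, x (i + (l + 1)) ≠ x (i + 1 + (l + 1)) := by
      obtain ⟨i, hi⟩ := hne
      refine ⟨i - (l + 1), ?_⟩
      rwa [add_right_comm (i - (l + 1)), sub_add_cancel]
    have hrot := h.rotate (l + 1)
    exact absurd (hrot.straight_deleteLast hlast)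
      (ih (by omega) (hrot.deleteLast hlast) (exists_apply_skipLast_ne hlast hne') 0)

theorem forall_ne [NeZero k] (hf : ContMDiff (𝓡 m) 𝓘(ℝ, EuclideanSpace ℝ (Fin n)) 2 f)
    (hinj : Function.Injective f) (hgen : IsGenericUpTo (m := m) f k) {x : ZMod k → M}
    {e : ZMod k → EuclideanSpace ℝ (Fin n)} (h : IsLimitPolygon (𝓡 m) f x e)
    (hne : ∃ i, x i ≠ x (i + 1)) (i : ZMod k) : x i ≠ x (i + 1) := by
  obtain ⟨j, rfl⟩ := Nat.exists_eq_succ_of_ne_zero (NeZero.ne k)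
  exact fun hi => h.not_isStraightTangentVertex hf hinj hgen le_rfl hne i
    (h.straight_of_collapsed hi)

end IsLimitPolygon

end GenericLimitPolygons

/-! ### Limits of trajectories -/

section Closedness

theorem sum_sub_apply_add_one {A : Type*} [AddCommGroup A] {k : ℕ} [NeZero k] (p : ZMod k → A) :
    ∑ i, (p i - p (i + 1)) = 0 := by
  rw [Finset.sum_sub_distrib, sub_eq_zero]
  exact (Equiv.sum_comp (Equiv.addRight (1 : ZMod k)) p).symm

theorem exists_inner_edgeDirection_nonpos {W : Type*} [NormedAddCommGroup W]
    [InnerProductSpace ℝ W] {k : ℕ} [NeZero k] (p : ZMod k → W) (e : W) :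
    ∃ i, inner ℝ (edgeDirection p i) e ≤ 0 := by
  have hsum : ∑ i, inner ℝ (p i - p (i + 1)) e = 0 := by
    rw [← sum_inner, sum_sub_apply_add_one, inner_zero_left]
  obtain ⟨i, -, hi⟩ := Finset.exists_le_of_sum_le (g := fun _ => (0 : ℝ)) Finset.univ_nonempty
    (hsum.le.trans_eq Finset.sum_const_zero.symm)
  refine ⟨i, ?_⟩
  rw [edgeDirection, NormedSpace.normalize, real_inner_smul_left]
  exact mul_nonpos_of_nonneg_of_nonpos (inv_nonneg.2 (norm_nonneg _)) hi

section Families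

variable {E E' H G' M N W α : Type*} [NormedAddCommGroup E] [NormedSpace ℝ E]
  [TopologicalSpace H] {I : ModelWithCorners ℝ E H} [TopologicalSpace M] [ChartedSpace H M]
  [NormedAddCommGroup E'] [NormedSpace ℝ E'] [TopologicalSpace G'] {J : ModelWithCorners ℝ E' G'}
  [TopologicalSpace N] [ChartedSpace G' N] [NormedAddCommGroup W] [InnerProductSpace ℝ W]
  {F : M × N → W} {l : Filter α} [l.NeBot] {τ : α → N} {t₀ : N} {p : M} {a b : α → M} {e : W}

/-- A polygon all of whose edges collapse has its edge directions converging to one unit vector,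
although the edges add up to zero. -/
theorem IsLimitPolygon.exists_ne {f : M → W} {k : ℕ} [NeZero k] {x : ZMod k → M} {e : ZMod k → W}
    (h : IsLimitPolygon I f x e) {p : α → ZMod k → W}
    (he : ∀ i, Tendsto (fun z => edgeDirection (p z) i) l (𝓝 (e i))) : ∃ i, x i ≠ x (i + 1) := by
  by_contra! hcollapsed
  have hpos : ∀ᶠ z in l, ∀ i, 0 < inner ℝ (edgeDirection (p z) i) (e 0) := by
    refine eventually_all.2 fun i => ((he i).inner tendsto_const_nhds).eventually (lt_mem_nhds ?_)
    rw [h.apply_eq_apply_zero hcollapsed i, real_inner_self_eq_norm_sq, h.norm_eq_one]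
    exact one_pos.trans_eq (one_pow 2).symm
  obtain ⟨z, hz⟩ := hpos.exists
  obtain ⟨i, hi⟩ := exists_inner_edgeDirection_nonpos (p z) (e 0)
  exact (hz i).not_ge hi

theorem mem_tangentImage_of_tendsto_normalize_sub [I.Boundaryless] [IsManifold I 1 M]
    [IsManifold J 1 N] [FiniteDimensional ℝ E] (hF : ContMDiff (I.prod J) 𝓘(ℝ, W) 1 F)
    (himm : Function.Injective (mfderiv I 𝓘(ℝ, W) (fun p => F (p, t₀)) p))
    (hτ : Tendsto τ l (𝓝 t₀)) (ha : Tendsto a l (𝓝 p)) (hb : Tendsto b l (𝓝 p))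
    (he : Tendsto (fun z => NormedSpace.normalize (F (a z, τ z) - F (b z, τ z))) l (𝓝 e)) :
    e ∈ tangentImage I (fun p => F (p, t₀)) p := by
  set φ := extChartAt I p
  have : CompleteSpace E := FiniteDimensional.complete ℝ E
  have hslice : MDifferentiable I 𝓘(ℝ, W) fun p => F (p, t₀) :=
    (hF.comp (contMDiff_id.prodMk contMDiff_const)).mdifferentiable one_ne_zero
  have hinj := injective_fderiv_comp_extChartAt_symm (mem_extChartAt_target p) (hslice _)
    (by rwa [extChartAt_to_inv])
  obtain ⟨K, -, hK⟩ := (fderiv ℝ ((fun p => F (p, t₀)) ∘ φ.symm) (φ p)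
    : E →ₗ[ℝ] W).exists_antilipschitzWith (LinearMap.ker_eq_bot.2 hinj)
  have hleft : ∀ {c : α → M}, Tendsto c l (𝓝 p) → ∀ᶠ z in l, φ.symm (φ (c z)) = c z := fun hc =>
    (hc.eventually (extChartAt_source_mem_nhds p)).mono fun z hz => φ.left_inv hz
  have hφ : Tendsto φ (𝓝 p) (𝓝 (φ p)) := continuousAt_extChartAt p
  have hmem := (hasUniformStrictFDerivAt_of_contMDiffAt (contMDiffAt_family_comp_extChartAt_symm hF
    (mem_extChartAt_target p))).mem_range_of_tendsto_normalize_sub hK hτ (hφ.comp ha) (hφ.comp hb)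
    (he.congr' ?_)
  · have hrange := range_fderiv_comp_extChartAt_symm (mem_extChartAt_target p) (hslice _)
    rw [extChartAt_to_inv] at hrange
    rwa [← hrange]
  · filter_upwards [hleft ha, hleft hb] with z hza hzb
    change _ = NormedSpace.normalize (F (φ.symm (φ (a z)), τ z) - F (φ.symm (φ (b z)), τ z))
    rw [hza, hzb]

theorem mem_orthogonal_tangentImage_of_tendsto [I.Boundaryless] [IsManifold I 1 M]
    [IsManifold J 1 N] (hF : ContMDiff (I.prod J) 𝓘(ℝ, W) 1 F) {d : α → W}
    (hτ : Tendsto τ l (𝓝 t₀)) (ha : Tendsto a l (𝓝 p)) (hd : Tendsto d l (𝓝 e))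
    (horth : ∀ᶠ z in l, d z ∈ (tangentImage I (fun p => F (p, τ z)) (a z))ᗮ) :
    e ∈ (tangentImage I (fun p => F (p, t₀)) p)ᗮ := by
  set φ := extChartAt I p
  have hrange {t : N} {q : M} (hq : q ∈ φ.source) :
      (fderiv ℝ ((fun p => F (p, t)) ∘ φ.symm) (φ q)).range =
        tangentImage I (fun p => F (p, t)) q := by
    have hslice : ContMDiff I 𝓘(ℝ, W) 1 fun p => F (p, t) :=
      hF.comp (contMDiff_id.prodMk contMDiff_const)
    rw [range_fderiv_comp_extChartAt_symm (φ.map_source hq)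
      (hslice.mdifferentiable one_ne_zero _), φ.left_inv hq]
  have hφ : Tendsto φ (𝓝 p) (𝓝 (φ p)) := continuousAt_extChartAt p
  have hfderiv : Tendsto (fun z => fderiv ℝ ((fun p => F (p, τ z)) ∘ φ.symm) (φ (a z))) l
      (𝓝 (fderiv ℝ ((fun p => F (p, t₀)) ∘ φ.symm) (φ p))) :=
    (contMDiffAt_partial_fderiv (s := 0) (by simp) (contMDiffAt_family_comp_extChartAt_symm hF
      (mem_extChartAt_target p))).continuousAt.tendsto.comp (hτ.prodMk_nhds (hφ.comp ha))
  rw [← hrange (mem_extChartAt_source p), Submodule.mem_orthogonal']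
  rintro _ ⟨v, rfl⟩
  refine tendsto_nhds_unique
    (hd.inner (((ContinuousLinearMap.apply ℝ W v).continuous.tendsto _).comp hfderiv))
    (tendsto_const_nhds.congr' ?_)
  filter_upwards [horth, ha.eventually (extChartAt_source_mem_nhds (I := I) p)] with z hz hza
  rw [← hrange hza, Submodule.mem_orthogonal'] at hz
  exact (hz _ ⟨v, rfl⟩).symm

end Families

section Trajectories

variable {n m k : ℕ} {E' G' M N α : Type*} [NormedAddCommGroup E'] [NormedSpace ℝ E']
  [TopologicalSpace G'] {J : ModelWithCorners ℝ E' G'} [TopologicalSpace N] [ChartedSpace G' N]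
  [IsManifold J 1 N] [TopologicalSpace M] [ChartedSpace (EuclideanSpace ℝ (Fin m)) M]
  {F : M × N → EuclideanSpace ℝ (Fin n)}

theorem isLimitPolygon_of_tendsto [IsManifold (𝓡 m) 1 M]
    (hF : ContMDiff ((𝓡 m).prod J) 𝓘(ℝ, EuclideanSpace ℝ (Fin n)) 1 F)
    (hinj : ∀ t, Function.Injective fun p => F (p, t)) {t₀ : N}
    (himm : ∀ p, Function.Injective
      (mfderiv (𝓡 m) 𝓘(ℝ, EuclideanSpace ℝ (Fin n)) (fun p => F (p, t₀)) p))
    {l : Filter α} [l.NeBot] {τ : α → N} {y : α → ZMod k → M} {x : ZMod k → M}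
    {e : ZMod k → EuclideanSpace ℝ (Fin n)} (hτ : Tendsto τ l (𝓝 t₀)) (hy : Tendsto y l (𝓝 x))
    (hmem : ∀ᶠ z in l, IsClosedTrajectory (m := m) (fun p => F (p, τ z)) (y z))
    (he : ∀ i, Tendsto (fun z => edgeDirection (fun j => F (y z j, τ z)) i) l (𝓝 (e i))) :
    IsLimitPolygon (𝓡 m) (fun p => F (p, t₀)) x e where
  norm_eq_one i := by
    refine tendsto_nhds_unique (he i).norm (tendsto_const_nhds.congr' ?_)
    filter_upwards [hmem] with z hz
    exact (norm_edgeDirection (p := fun j => F (y z j, τ z)) ((hinj (τ z)).ne (hz.1 i))).symm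
  eq_edgeDirection i hi := by
    have hvertex j : Tendsto (fun z => F (y z j, τ z)) l (𝓝 (F (x j, t₀))) :=
      (hF.continuous.tendsto (x j, t₀)).comp ((tendsto_pi_nhds.1 hy j).prodMk_nhds hτ)
    have hedge := (hvertex i).sub (hvertex (i + 1))
    have hne : ‖F (x i, t₀) - F (x (i + 1), t₀)‖ ≠ 0 :=
      norm_ne_zero_iff.2 (sub_ne_zero.2 ((hinj t₀).ne hi))
    exact tendsto_nhds_unique (he i) ((hedge.norm.inv₀ hne).smul hedge)
  mem_tangentImage i hi := by
    have hnext := tendsto_pi_nhds.1 hy (i + 1)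
    rw [← hi] at hnext
    exact mem_tangentImage_of_tendsto_normalize_sub hF (himm _) hτ (tendsto_pi_nhds.1 hy i) hnext
      (he i)
  reflection i := by
    refine mem_orthogonal_tangentImage_of_tendsto hF hτ (tendsto_pi_nhds.1 hy i)
      ((he i).sub (he (i - 1))) ?_
    filter_upwards [hmem] with z hz
    exact (isClosedTrajectory_iff.1 hz).2 i

theorem isClosed_trajectories [NeZero k] [IsManifold (𝓡 m) 2 M]
    (hF : ContMDiff ((𝓡 m).prod J) 𝓘(ℝ, EuclideanSpace ℝ (Fin n)) 2 F)
    (hinj : ∀ t, Function.Injective fun p => F (p, t))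
    (himm : ∀ t p, Function.Injective
      (mfderiv (𝓡 m) 𝓘(ℝ, EuclideanSpace ℝ (Fin n)) (fun p => F (p, t)) p))
    (hgen : ∀ t, IsGenericUpTo (m := m) (fun p => F (p, t)) k) :
    IsClosed {q : (ZMod k → M) × N | q.1 ∈ trajectories (m := m) (fun p => F (p, q.2)) k} := by
  have : IsManifold (𝓡 m) 1 M := IsManifold.of_le one_le_two
  refine isClosed_iff_ultrafilter.2 fun ⟨x, t⟩ u hu hmem => ?_
  let d (q : (ZMod k → M) × N) : ZMod k → EuclideanSpace ℝ (Fin n) :=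
    edgeDirection fun j => F (q.1 j, q.2)
  have hd : ∀ᶠ q in u, d q ∈ closedBall 0 1 := by
    filter_upwards [hmem] with q hq
    exact mem_closedBall_zero_iff.2 <| (pi_norm_le_iff_of_nonneg zero_le_one).2 fun i =>
      (norm_edgeDirection ((hinj q.2).ne (hq.1 i))).le
  obtain ⟨e, -, he⟩ := (isCompact_closedBall _ _).ultrafilter_le_nhds (u.map d)
    (le_principal_iff.2 hd)
  have he' := tendsto_pi_nhds.1 (show Tendsto d u (𝓝 e) from he)
  have hpoly : IsLimitPolygon (𝓡 m) (fun p => F (p, t)) x e :=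
    isLimitPolygon_of_tendsto (hF.of_le one_le_two) hinj (himm t)
      ((continuous_snd.tendsto (x, t)).mono_left hu) ((continuous_fst.tendsto (x, t)).mono_left hu)
      hmem he'
  exact hpoly.isClosedTrajectory (hpoly.forall_ne
    (hF.comp (contMDiff_id.prodMk contMDiff_const)) (hinj t) (hgen t) (hpoly.exists_ne he'))

end Trajectories

end Closedness

/-! ### Dihedral symmetries -/

section Dihedral

variable {k : ℕ} {M : Type*}

/-- The action of the dihedral group on labelled polygons: `(c, false)` rotates the labels by `c`,
`(c, true)` reflects them by `i ↦ c - i`. -/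
def dihedralMap (g : ZMod k × Bool) (x : ZMod k → M) : ZMod k → M :=
  fun i => if g.2 then x (g.1 - i) else x (g.1 + i)

theorem continuous_dihedralMap [TopologicalSpace M] (g : ZMod k × Bool) :
    Continuous (dihedralMap (M := M) g) := by
  refine continuous_pi fun i => ?_
  unfold dihedralMap
  split_ifs <;> exact continuous_apply _

theorem dihedralSetoid_iff (x y : ZMod k → M) :
    dihedralSetoid k M x y ↔ ∃ g, y = dihedralMap g x := by
  simp only [dihedralMap, Prod.exists, Bool.exists_bool, funext_iff, if_true, Bool.false_eq_true,
    if_false]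
  rfl

section Trajectories

variable {n m : ℕ} [TopologicalSpace M] [ChartedSpace (EuclideanSpace ℝ (Fin m)) M]
  {f : M → EuclideanSpace ℝ (Fin n)} {x : ZMod k → M}

theorem IsClosedTrajectory.rotate (hx : IsClosedTrajectory (m := m) f x) (c : ZMod k) :
    IsClosedTrajectory (m := m) f fun i => x (c + i) := by
  obtain ⟨hne, href⟩ := isClosedTrajectory_iff.1 hx
  refine isClosedTrajectory_iff.2 ⟨fun i => ?_, fun i => ?_⟩
  · rw [← add_assoc]
    exact hne (c + i)
  · have hdir := edgeDirection_rotate (f ∘ x) c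
    simp only [Function.comp_def] at hdir ⊢
    rw [hdir, hdir, ← add_sub_assoc]
    exact href (c + i)

theorem IsClosedTrajectory.reflect (hx : IsClosedTrajectory (m := m) f x) (c : ZMod k) :
    IsClosedTrajectory (m := m) f fun i => x (c - i) := by
  obtain ⟨hne, href⟩ := isClosedTrajectory_iff.1 hx
  refine isClosedTrajectory_iff.2 ⟨fun i => ?_, fun i => ?_⟩
  · have hedge := hne (c - (i + 1))
    rw [sub_add_eq_sub_sub, sub_add_cancel] at hedge
    rw [sub_add_eq_sub_sub]
    exact hedge.symm
  · have hdir := edgeDirection_reflect (f ∘ x) c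
    simp only [Function.comp_def] at hdir ⊢
    rw [hdir, hdir, neg_sub_neg, sub_sub_eq_add_sub, add_sub_right_comm, add_sub_cancel_right]
    exact href (c - i)

theorem dihedralMap_mem_trajectories (hx : x ∈ trajectories (m := m) f k) (g : ZMod k × Bool) :
    dihedralMap g x ∈ trajectories (m := m) f k := by
  obtain ⟨c, reflected⟩ := g
  cases reflected
  · exact IsClosedTrajectory.rotate hx c
  · exact IsClosedTrajectory.reflect hx c

theorem mem_trajectories_of_quotient_mk_eq {y : ZMod k → M}
    (hxy : Quotient.mk (dihedralSetoid k M) x = Quotient.mk (dihedralSetoid k M) y)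
    (hx : x ∈ trajectories (m := m) f k) : y ∈ trajectories (m := m) f k := by
  obtain ⟨g, rfl⟩ := (dihedralSetoid_iff x y).1 (Quotient.exact hxy)
  exact dihedralMap_mem_trajectories hx g

end Trajectories

end Dihedral

end Billiard

end

theorem mainTheorem2_general {n m : ℕ} {M N E' H : Type*} [TopologicalSpace M] [T2Space M]
    [CompactSpace M] [ChartedSpace (EuclideanSpace ℝ (Fin m)) M] [IsManifold (𝓡 m) 2 M]
    [NormedAddCommGroup E'] [NormedSpace ℝ E'] [TopologicalSpace H] {J : ModelWithCorners ℝ E' H}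
    [TopologicalSpace N] [PreconnectedSpace N] [ChartedSpace H N] [IsManifold J 1 N]
    {F : M × N → EuclideanSpace ℝ (Fin n)}
    (hF : ContMDiff ((𝓡 m).prod J) 𝓘(ℝ, EuclideanSpace ℝ (Fin n)) 2 F)
    (hinj : ∀ t, Function.Injective fun p => F (p, t))
    (himm : ∀ t p, Function.Injective
      (mfderiv (𝓡 m) 𝓘(ℝ, EuclideanSpace ℝ (Fin n)) (fun p => F (p, t)) p))
    {k : ℕ} (hk : 2 ≤ k) (hgen : ∀ t, Billiard.IsGenericUpTo (m := m) (fun p => F (p, t)) k) :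
    (∀ t, (Billiard.trajectories (m := m) (fun p => F (p, t)) k).Finite) ∧
    ∀ s t,
      (Billiard.trajectories (m := m) (fun p => F (p, s)) k).ncard =
        (Billiard.trajectories (m := m) (fun p => F (p, t)) k).ncard ∧
      (Billiard.unlabelledTrajectories (m := m) (fun p => F (p, s)) k).ncard =
        (Billiard.unlabelledTrajectories (m := m) (fun p => F (p, t)) k).ncard := by
  have : NeZero k := ⟨by omega⟩
  have : IsManifold (𝓡 m) 1 M := IsManifold.of_le one_le_two
  let T (t : N) := Billiard.trajectories (m := m) (fun p => F (p, t)) k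
  have hclosed : IsClosed {q : (ZMod k → M) × N | q.1 ∈ T q.2} :=
    Billiard.isClosed_trajectories hF hinj himm hgen
  have hpers t x (hx : x ∈ T t) : Billiard.PersistsUniquely T t x := by
    have hslice : ContMDiff (𝓡 m) 𝓘(ℝ, EuclideanSpace ℝ (Fin n)) 2 fun p => F (p, t) :=
      hF.comp (contMDiff_id.prodMk contMDiff_const)
    exact Billiard.persistsUniquely_trajectories hF (hinj t) hx <| hgen t k hk le_rfl x hx.1 <|
      (Billiard.isCriticalPoint_iff_isClosedTrajectory (hslice.mdifferentiable two_ne_zero)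
        fun i => (hinj t).ne (hx.1 i)).2 hx
  have : T2Space (Quotient (Billiard.dihedralSetoid k M)) :=
    Billiard.t2Space_quotient Billiard.continuous_dihedralMap Billiard.dihedralSetoid_iff
  have hπ : IsOpenQuotientMap (Quotient.mk (Billiard.dihedralSetoid k M)) :=
    Billiard.isOpenQuotientMap_quotient_mk Billiard.continuous_dihedralMap
      Billiard.dihedralSetoid_iff
  have hinv t (x y) (hxy : Quotient.mk (Billiard.dihedralSetoid k M) x = Quotient.mk _ y)
      (hx : x ∈ T t) : y ∈ T t := Billiard.mem_trajectories_of_quotient_mk_eq hxy hx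
  exact ⟨fun t => Billiard.finite_fibre (T := T) hclosed (hpers t), fun s t =>
    ⟨Billiard.ncard_fibre_eq hclosed hpers s t,
      Billiard.ncard_image_fibre_eq hπ hinv hclosed hpers s t⟩⟩

theorem mainTheorem2 {n m : ℕ} {M : Type*} [TopologicalSpace M] [T2Space M] [CompactSpace M]
    [ChartedSpace (EuclideanSpace ℝ (Fin m)) M] [IsManifold (𝓡 m) ∞ M]
    (F : M × unitInterval → EuclideanSpace ℝ (Fin n))
    (hF : ContMDiff ((𝓡 m).prod (𝓡∂ 1)) 𝓘(ℝ, EuclideanSpace ℝ (Fin n)) ∞ F)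
    (k : ℕ) (hk : 2 ≤ k)
    (hemb : ∀ t : unitInterval, Manifold.IsSmoothEmbedding (𝓡 m)
      𝓘(ℝ, EuclideanSpace ℝ (Fin n)) ∞ fun p : M => F (p, t))
    (hgen : ∀ t : unitInterval, Billiard.IsGenericUpTo (m := m) (fun p : M => F (p, t)) k) :
    (∀ t : unitInterval, (Billiard.trajectories (m := m) (fun p : M => F (p, t)) k).Finite) ∧
    ∀ s t : unitInterval,
      (Billiard.trajectories (m := m) (fun p : M => F (p, s)) k).ncard =
        (Billiard.trajectories (m := m) (fun p : M => F (p, t)) k).ncard ∧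
      (Billiard.unlabelledTrajectories (m := m) (fun p : M => F (p, s)) k).ncard =
        (Billiard.unlabelledTrajectories (m := m) (fun p : M => F (p, t)) k).ncard :=
  mainTheorem2_general (hF.of_le ENat.LEInfty.out) (fun t => (hemb t).isEmbedding.injective)
    (fun t p => Billiard.injective_mfderiv_of_isImmersionAt (by simp)
      ((hemb t).isImmersion.isImmersionAt p)) hk hgen
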